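/- All rings are associative and unital. Let $R$ be a ring and let $M$ be an $(R,R)$-bimodule. The trivial extension $R\propto M$ is the ring $R\times M$ with componentwise addition and multiplication $(r,m)(s,n)=(rs,\,rn+ms)$. A ring $S$ is left quasi-morphic if for every $a\in S$ there are $b,c\in S$ with $\mathrm{ann}_l(a)=Sb$ and $\mathrm{ann}_l(c)=Sa$; it is left morphic if for every $a\in S$ one has $S/Sa\cong \mathrm{ann}_l(a)$ as left $S$-modules. Right quasi-morphic and right morphic are defined symmetrically, and $S$ is (quasi-)morphic if it is both left and right (quasi-)morphic. An artinian ring is one that is artinian on both sides, and a principal ring is one in which every left ideal and every right ideal is principal. For an endomorphism $\sigma$ of a ring $S$, $S(\sigma)$ denotes the $(S,S)$-bimodule that equals $S$ as a left module and has right action $s\cdot r=s\,\sigma(r)$. Suppose that $R\propto M$ is quasi-morphic, that $R$ satisfies the ascending chain condition on principal left ideals, and that ${}_RM$ is finitely generated. Then $R$ is an artinian principal ring and $R\propto M$ is morphic. Moreover, $R=R_1\times\dots\times R_n$ for some $n\ge 0$, where each $R_i$ is a full matrix ring $\mathbb{M}_{k_i}(L_i)$, $k_i\ge 1$, over an artinian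 principal local ring $L_i$, and $M=M_1\oplus\dots\oplus M_n$, where each $M_i$ is an $(R_i,R_i)$-bimodule and $R$ acts componentwise on both sides; if $R_i$ is simple artinian, then $M_i=0$ or $M_i\cong R_i(\sigma_i)$ as bimodules for some automorphism $\sigma_i$ of $R_i$, and if $R_i$ is not simple artinian, then $M_i=0$. -/

import Mathlib

open MulOpposite

universe u v

/- Conventions: `Ideal S = Submodule S S` is the type of left ideals of a (not necessarily
commutative) ring `S`, and `Submodule Sᵐᵒᵖ S` is the type of right ideals of `S`. A right action
of `S` on `M` is an action of `Sᵐᵒᵖ`, so that `op r • m` is the product `m r`. -/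

section Morphic

variable (S : Type u) [Ring S]

/-- The principal left ideal `S a`. -/
def leftPrincipal {S : Type u} [Ring S] (a : S) : Submodule S S := Submodule.span S {a}

/-- The principal right ideal `a S`. -/
def rightPrincipal {S : Type u} [Ring S] (a : S) : Submodule Sᵐᵒᵖ S := Submodule.span Sᵐᵒᵖ {a}

/-- The left annihilator of `a`, the set of all `x` with `x a = 0`, as a left ideal. -/
def leftAnn {S : Type u} [Ring S] (a : S) : Submodule S S where
  carrier := {x | x * a = 0}
  add_mem' := by
    intro x y hx hy
    simp only [Set.mem_ofPred_eq] at *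
    rw [add_mul, hx, hy, add_zero]
  zero_mem' := by simp
  smul_mem' := by
    intro c x hx
    simp only [Set.mem_ofPred_eq, smul_eq_mul] at *
    rw [mul_assoc, hx, mul_zero]

/-- The right annihilator of `a`, the set of all `x` with `a x = 0`, as a right ideal. -/
def rightAnn {S : Type u} [Ring S] (a : S) : Submodule Sᵐᵒᵖ S where
  carrier := {x | a * x = 0}
  add_mem' := by
    intro x y hx hy
    simp only [Set.mem_ofPred_eq] at *
    rw [mul_add, hx, hy, add_zero]
  zero_mem' := by simp
  smul_mem' := by
    intro c x hx
    simp only [Set.mem_ofPred_eq] at *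
    rw [← op_unop c, op_smul_eq_mul, ← mul_assoc, hx, zero_mul]

/-- Every `a` satisfies `S / S a ≅ ann_l(a)` as left modules. -/
def IsLeftMorphicRing : Prop :=
  ∀ a : S, Nonempty ((S ⧸ leftPrincipal a) ≃ₗ[S] leftAnn a)

/-- Every `a` satisfies `S / a S ≅ ann_r(a)` as right modules. -/
def IsRightMorphicRing : Prop :=
  ∀ a : S, Nonempty ((S ⧸ rightPrincipal a) ≃ₗ[Sᵐᵒᵖ] rightAnn a)

/-- A morphic ring: left and right morphic. -/
def IsMorphicRing : Prop := IsLeftMorphicRing S ∧ IsRightMorphicRing S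

/-- For every `a` there are `b`, `c` with `ann_l(a) = S b` and `ann_l(c) = S a`. -/
def IsLeftQuasiMorphicRing : Prop :=
  ∀ a : S, ∃ b c : S, leftAnn a = leftPrincipal b ∧ leftAnn c = leftPrincipal a

/-- For every `a` there are `b`, `c` with `ann_r(a) = b S` and `ann_r(c) = a S`. -/
def IsRightQuasiMorphicRing : Prop :=
  ∀ a : S, ∃ b c : S, rightAnn a = rightPrincipal b ∧ rightAnn c = rightPrincipal a

/-- A quasi-morphic ring: left and right quasi-morphic. -/
def IsQuasiMorphicRing : Prop := IsLeftQuasiMorphicRing S ∧ IsRightQuasiMorphicRing S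

/-- Artinian on both sides. -/
def IsTwoSidedArtinianRing : Prop := IsArtinian S S ∧ IsArtinian Sᵐᵒᵖ S

/-- A principal ring: every left ideal and every right ideal is principal. -/
def IsPrincipalRing : Prop :=
  (∀ I : Submodule S S, I.IsPrincipal) ∧ (∀ I : Submodule Sᵐᵒᵖ S, I.IsPrincipal)

/-- The ascending chain condition on principal left ideals. -/
def ACCPrincipalLeftIdeals : Prop :=
  WellFoundedGT {I : Submodule S S // I.IsPrincipal}

/-- A simple artinian ring. -/
def IsSimpleArtinianRing : Prop := IsSimpleRing S ∧ IsTwoSidedArtinianRing S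

end Morphic

section Bimodules

/-- The `(R, R)`-bimodule `R(σ)`: it is `R` as a left module, with right action
`s · r = s * σ r`. -/
def TwistedBimodule {R : Type u} [Ring R] (_σ : R →+* R) : Type u := R

namespace TwistedBimodule

variable {R : Type u} [Ring R] (σ : R →+* R)

instance : AddCommGroup (TwistedBimodule σ) := inferInstanceAs (AddCommGroup R)

instance : Module R (TwistedBimodule σ) := inferInstanceAs (Module R R)

instance : Module Rᵐᵒᵖ (TwistedBimodule σ) :=
  Module.compHom R (RingHom.op σ : Rᵐᵒᵖ →+* Rᵐᵒᵖ)

/-- The identity map, as an additive isomorphism from `R` onto `R(σ)`. -/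
def of : R ≃+ TwistedBimodule σ := AddEquiv.refl R

theorem smul_of (r s : R) : r • of σ s = of σ (r * s) := rfl

theorem op_smul_of (r s : R) : op r • of σ s = of σ (s * σ r) := rfl

instance : SMulCommClass R Rᵐᵒᵖ (TwistedBimodule σ) where
  smul_comm a b c := (mul_assoc (a : R) (c : R) (σ b.unop)).symm

end TwistedBimodule

/-- Two `(R, R)`-bimodules are isomorphic. -/
def BimoduleIsomorphic (R : Type u) [Ring R] (M N : Type*)
    [AddCommGroup M] [Module R M] [Module Rᵐᵒᵖ M]
    [AddCommGroup N] [Module R N] [Module Rᵐᵒᵖ N] : Prop :=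
  ∃ g : M ≃+ N, (∀ (r : R) (m : M), g (r • m) = r • g m) ∧
    (∀ (r : R) (m : M), g (op r • m) = op r • g m)

/-- `R = R₁ × ⋯ × Rₙ` (through `e`), where `Rᵢ` is the ring of `kᵢ × kᵢ` matrices over an artinian
principal local ring `Lᵢ`, and `M = N₁ ⊕ ⋯ ⊕ Nₙ` (through `f`) for `(Rᵢ, Rᵢ)`-bimodules `Nᵢ`, with
`R` acting componentwise on both sides. If `Rᵢ` is simple artinian, then `Nᵢ = 0` or
`Nᵢ ≅ Rᵢ(σ)` for an automorphism `σ` of `Rᵢ`; otherwise `Nᵢ = 0`. -/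
def HasMatrixTwistDecomposition (R : Type u) (M : Type v) [Ring R] [AddCommGroup M]
    [Module R M] [Module Rᵐᵒᵖ M] : Prop :=
  ∃ (n : ℕ) (k : Fin n → ℕ) (L : Fin n → Type u) (_ : ∀ i, Ring (L i))
    (N : Fin n → Type v) (_ : ∀ i, AddCommGroup (N i))
    (_ : ∀ i, Module (Matrix (Fin (k i)) (Fin (k i)) (L i)) (N i))
    (_ : ∀ i, Module (Matrix (Fin (k i)) (Fin (k i)) (L i))ᵐᵒᵖ (N i))
    (_ : ∀ i, SMulCommClass (Matrix (Fin (k i)) (Fin (k i)) (L i))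
      (Matrix (Fin (k i)) (Fin (k i)) (L i))ᵐᵒᵖ (N i))
    (e : R ≃+* (∀ i, Matrix (Fin (k i)) (Fin (k i)) (L i)))
    (f : M ≃+ (∀ i, N i)),
    (∀ i, 0 < k i) ∧
    (∀ i, IsLocalRing (L i) ∧ IsTwoSidedArtinianRing (L i) ∧ IsPrincipalRing (L i)) ∧
    (∀ (r : R) (m : M) (i : Fin n), f (r • m) i = e r i • f m i) ∧
    (∀ (r : R) (m : M) (i : Fin n), f (op r • m) i = op (e r i) • f m i) ∧
    (∀ i, IsSimpleArtinianRing (Matrix (Fin (k i)) (Fin (k i)) (L i)) →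
      Subsingleton (N i) ∨
      ∃ σ : Matrix (Fin (k i)) (Fin (k i)) (L i) ≃+* Matrix (Fin (k i)) (Fin (k i)) (L i),
        BimoduleIsomorphic (Matrix (Fin (k i)) (Fin (k i)) (L i)) (N i)
          (TwistedBimodule (σ : Matrix (Fin (k i)) (Fin (k i)) (L i) →+*
            Matrix (Fin (k i)) (Fin (k i)) (L i)))) ∧
    (∀ i, ¬ IsSimpleArtinianRing (Matrix (Fin (k i)) (Fin (k i)) (L i)) → Subsingleton (N i))

end Bimodules

/-! ### Annihilators and principal ideals in terms of elements, and passage to the opposite ring -/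

section Elementwise

variable {S : Type u} [Ring S]

/-! Write `S = R ∝ M`. In a quasi-morphic ring every principal one-sided ideal is an annihilator, so
a sum of two principal left ideals is principal. This property passes to the quotient `R`, where it
turns the chain condition into left noetherianity; since `M` is finitely generated, `S` is left
noetherian too.

A left noetherian quasi-morphic ring is an artinian principal ring. Maximal annihilators show that
it is von Neumann regular modulo its radical and that radical elements are nilpotent. The radical is
principal, hence nilpotent, and Hopkins–Levitzki gives left artinian. The right side follows because
left annihilators reverse the order of principal right ideals. So `S`, and with it `R`, is an
artinian principal ring.

An artinian principal ring is a finite product of matrix rings over local rings whose maximal ideal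
is `Tp = pT` with `p` nilpotent (`exists_ringEquiv_pi_matrix_isChainRing`). The central idempotents
of the semisimple quotient lift to idempotents that are again central (`commute_of_idempotent`),
matrix units lift, and a length count makes the maximal ideal principal. Matrices over such a ring
can be diagonalized with entries a unit times `p ^ i`, and pairing `p ^ i` with `p ^ (n - i)` shows
that the ring is morphic. Applied to `S`, this gives morphicity.

For the decomposition of `M`, the block idempotents of `R` commute with `M` by
`commute_of_idempotent` in `S`, so `S` splits into blocks `Rᵢ ∝ Mᵢ`. If `p ≠ 0`, the left ideal `Rᵢ
p × Mᵢ` is principal only when `Mᵢ = p Mᵢ + Mᵢ p`, which forces `Mᵢ = 0`. If `p = 0`, then `Rᵢ` is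
simple artinian; a nonzero `Mᵢ` is cyclic on both sides, quasi-morphicity makes a left generator `m`
free, and `m r = σ(r) m` defines the twist. -/

theorem mem_leftPrincipal {a x : S} : x ∈ leftPrincipal a ↔ ∃ y, y * a = x :=
  Submodule.mem_span_singleton

theorem mem_rightPrincipal {a x : S} : x ∈ rightPrincipal a ↔ ∃ y, a * y = x := by
  rw [rightPrincipal, Submodule.mem_span_singleton]
  exact ⟨fun ⟨y, hy⟩ => ⟨unop y, hy⟩, fun ⟨y, hy⟩ => ⟨op y, hy⟩⟩

theorem mem_leftAnn {a x : S} : x ∈ leftAnn a ↔ x * a = 0 := Iff.rfl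

theorem mem_rightAnn {a x : S} : x ∈ rightAnn a ↔ a * x = 0 := Iff.rfl

theorem leftAnn_eq_leftPrincipal {a b : S} :
    leftAnn a = leftPrincipal b ↔ ∀ x, x * a = 0 ↔ ∃ y, y * b = x := by
  simp only [SetLike.ext_iff, mem_leftAnn, mem_leftPrincipal]

theorem rightAnn_eq_rightPrincipal {a b : S} :
    rightAnn a = rightPrincipal b ↔ ∀ x, a * x = 0 ↔ ∃ y, b * y = x := by
  simp only [SetLike.ext_iff, mem_rightAnn, mem_rightPrincipal]

/-- The map `op`, as an isomorphism of right modules from `S` to its opposite ring. -/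
def opSelfLinearEquiv (S : Type u) [Ring S] : S ≃ₗ[Sᵐᵒᵖ] Sᵐᵒᵖ :=
  { (opAddEquiv : S ≃+ Sᵐᵒᵖ) with map_smul' := fun _ _ => rfl }

theorem forall_isPrincipal_congr {A : Type*} [Ring A] {M N : Type*} [AddCommGroup M]
    [AddCommGroup N] [Module A M] [Module A N] (f : M ≃ₗ[A] N)
    (h : ∀ I : Submodule A M, I.IsPrincipal) (I : Submodule A N) : I.IsPrincipal := by
  obtain ⟨a, ha⟩ := h (I.comap (f : M →ₗ[A] N))
  refine ⟨f a, ?_⟩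
  rw [← Submodule.map_comap_eq_of_surjective (f := (f : M →ₗ[A] N)) f.surjective I, ha,
    Submodule.map_span, Set.image_singleton]
  rfl

theorem isPrincipalRing_iff :
    IsPrincipalRing S ↔
      (∀ I : Ideal S, I.IsPrincipal) ∧ (∀ I : Ideal Sᵐᵒᵖ, I.IsPrincipal) :=
  and_congr_right fun _ => ⟨fun h => forall_isPrincipal_congr (opSelfLinearEquiv S) h,
    fun h => forall_isPrincipal_congr (opSelfLinearEquiv S).symm h⟩

theorem isTwoSidedArtinianRing_iff :
    IsTwoSidedArtinianRing S ↔ IsArtinianRing S ∧ IsArtinianRing Sᵐᵒᵖ :=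
  and_congr_right fun _ => (opSelfLinearEquiv S).isArtinian_iff

theorem isRightQuasiMorphicRing_iff :
    IsRightQuasiMorphicRing S ↔ IsLeftQuasiMorphicRing Sᵐᵒᵖ := by
  simp only [IsRightQuasiMorphicRing, IsLeftQuasiMorphicRing, leftAnn_eq_leftPrincipal,
    rightAnn_eq_rightPrincipal, MulOpposite.forall, MulOpposite.exists, ← op_mul, op_inj,
    op_eq_zero_iff]

theorem IsQuasiMorphicRing.op (h : IsQuasiMorphicRing S) : IsQuasiMorphicRing Sᵐᵒᵖ := by
  refine ⟨isRightQuasiMorphicRing_iff.1 h.2, ?_⟩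
  have := h.1
  simp only [IsRightQuasiMorphicRing, IsLeftQuasiMorphicRing, leftAnn_eq_leftPrincipal,
    rightAnn_eq_rightPrincipal, MulOpposite.forall, MulOpposite.exists, ← op_mul, op_inj,
    op_eq_zero_iff] at this ⊢
  exact this

end Elementwise

/-! ### Sums of principal left ideals, and the noetherian condition -/

section Bezout

variable {S : Type u} [Ring S]

/-- With `Sa = ann_l(c)` and `Sbc = ann_l(d)`, one has `xcd = 0` iff `xc = qbc` for some `q`, iff `x
- qb ∈ Sa`. So `Sa + Sb = ann_l(cd)`, again principal. -/
theorem IsLeftQuasiMorphicRing.sup_isPrincipal (h : IsLeftQuasiMorphicRing S)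
    {I J : Ideal S} (hI : I.IsPrincipal) (hJ : J.IsPrincipal) :
    Submodule.IsPrincipal (I ⊔ J) := by
  obtain ⟨a, rfl⟩ := hI
  obtain ⟨b, rfl⟩ := hJ
  obtain ⟨-, c, -, hc⟩ := h a
  obtain ⟨-, d, -, hd⟩ := h (b * c)
  obtain ⟨g, -, hg, -⟩ := h (c * d)
  rw [leftAnn_eq_leftPrincipal] at hc hd hg
  refine ⟨g, ?_⟩
  ext x
  rw [Submodule.mem_span_singleton, Submodule.mem_sup]
  simp only [Submodule.mem_span_singleton, smul_eq_mul]
  rw [← hg, ← mul_assoc, hd]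
  constructor
  · rintro ⟨_, ⟨p, rfl⟩, _, ⟨q, rfl⟩, rfl⟩
    exact ⟨q, by rw [add_mul, (hc _).2 ⟨p, rfl⟩, zero_add, mul_assoc]⟩
  · rintro ⟨q, hq⟩
    obtain ⟨p, hp⟩ := (hc (x - q * b)).1 (by rw [sub_mul, mul_assoc, hq, sub_self])
    exact ⟨_, ⟨p, rfl⟩, _, ⟨q, rfl⟩, by rw [hp]; abel⟩

/-- Finitely generated left ideals are principal. -/
theorem isPrincipal_of_fg_of_sup
    (h : ∀ I J : Ideal S, I.IsPrincipal → J.IsPrincipal → Submodule.IsPrincipal (I ⊔ J))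
    {I : Ideal S} (hI : I.FG) : I.IsPrincipal :=
  Submodule.fg_induction (motive := fun I _ => I.IsPrincipal) (fun x => ⟨x, rfl⟩)
    (fun I J _ _ => h I J) I hI

/-- Stated for sums of principal ideals and not for quasi-morphic rings, since this property visibly
passes to quotients and `R` is a quotient of `R ∝ M`. -/
theorem sup_isPrincipal_of_surjective {A : Type*} [Ring A] (f : S →+* A)
    (hf : Function.Surjective f)
    (h : ∀ I J : Ideal S, I.IsPrincipal → J.IsPrincipal → Submodule.IsPrincipal (I ⊔ J))
    (I J : Ideal A) (hI : I.IsPrincipal) (hJ : J.IsPrincipal) :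
    Submodule.IsPrincipal (I ⊔ J) := by
  obtain ⟨a, rfl⟩ := hI
  obtain ⟨b, rfl⟩ := hJ
  obtain ⟨a, rfl⟩ := hf a
  obtain ⟨b, rfl⟩ := hf b
  obtain ⟨c, hc⟩ := h (Ideal.span {a}) (Ideal.span {b}) ⟨a, rfl⟩ ⟨b, rfl⟩
  refine ⟨f c, ?_⟩
  have h3 : (Ideal.span {a} ⊔ Ideal.span {b}).map f = (Ideal.span {c}).map f :=
    congrArg (Ideal.map f) hc
  rw [Ideal.map_sup, Ideal.map_span, Ideal.map_span, Ideal.map_span, Set.image_singleton,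
    Set.image_singleton, Set.image_singleton] at h3
  exact h3

theorem isNoetherianRing_of_accPrincipalLeftIdeals
    (h : ∀ I J : Ideal S, I.IsPrincipal → J.IsPrincipal → Submodule.IsPrincipal (I ⊔ J))
    (hacc : ACCPrincipalLeftIdeals S) : IsNoetherianRing S := by
  refine isNoetherian_iff_fg_wellFounded.2 ?_
  have : (fun I : Submodule S S => I.FG) = fun I => I.IsPrincipal :=
    funext fun I => propext ⟨isPrincipal_of_fg_of_sup h, fun hI => hI.fg⟩
  change WellFoundedGT {N : Submodule S S // (fun I : Submodule S S => I.FG) N}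
  rw [this]
  exact hacc

theorem forall_isPrincipal_of_surjective {A : Type*} [Ring A] (f : S →+* A)
    (hf : Function.Surjective f) (h : ∀ I : Ideal S, I.IsPrincipal) (I : Ideal A) :
    I.IsPrincipal := by
  obtain ⟨a, ha⟩ := h (I.comap f)
  refine ⟨f a, ?_⟩
  rw [← Ideal.map_comap_of_surjective f hf I, ha]
  change Ideal.map f (Ideal.span {a}) = Ideal.span {f a}
  rw [Ideal.map_span, Set.image_singleton]

end Bezout

/-! ### Noetherianity of the trivial extension -/

section Trivial

variable {R : Type u} {M : Type v} [Ring R] [AddCommGroup M] [Module R M]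
    [Module Rᵐᵒᵖ M] [SMulCommClass R Rᵐᵒᵖ M]

theorem TrivSqZeroExt.isNoetherianRing [IsNoetherianRing R] [Module.Finite R M] :
    IsNoetherianRing (TrivSqZeroExt R M) := by
  have : IsNoetherian R (R × M) := inferInstance
  have h : IsNoetherian R (TrivSqZeroExt R M) := this
  have : IsScalarTower R (TrivSqZeroExt R M) (TrivSqZeroExt R M) :=
    ⟨fun r x y => by
      ext
      · simp [mul_assoc]
      · simp [mul_smul, smul_add, smul_comm]⟩
  exact isNoetherian_of_tower R h

theorem TrivSqZeroExt.isNoetherianRing_of_isQuasiMorphicRing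
    (hqm : IsQuasiMorphicRing (TrivSqZeroExt R M)) (hacc : ACCPrincipalLeftIdeals R)
    (hfg : Module.Finite R M) : IsNoetherianRing (TrivSqZeroExt R M) := by
  have := isNoetherianRing_of_accPrincipalLeftIdeals (S := R)
    (sup_isPrincipal_of_surjective (TrivSqZeroExt.fstHom ℕ R M : TrivSqZeroExt R M →+* R)
      TrivSqZeroExt.fst_surjective fun I J => hqm.1.sup_isPrincipal) hacc
  exact TrivSqZeroExt.isNoetherianRing

end Trivial

/-! ### Left noetherian quasi-morphic rings are artinian principal rings -/

section Artinian

variable {S : Type u} [Ring S]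

theorem exists_mul_one_sub_eq_one {x : S} (hx : x ∈ Ring.jacobson S) :
    ∃ z, z * (1 - x) = 1 := by
  rw [← Ideal.jacobson_bot, Ideal.mem_jacobson_iff] at hx
  obtain ⟨z, hz⟩ := hx (-1)
  refine ⟨z, ?_⟩
  rw [Submodule.mem_bot] at hz
  rw [← sub_eq_zero, ← hz]
  noncomm_ring

theorem mem_jacobson_of_forall {x : S} (h : ∀ y, ∃ z, z * (1 - y * x) = 1) :
    x ∈ Ring.jacobson S := by
  rw [← Ideal.jacobson_bot, Ideal.mem_jacobson_iff]
  intro y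
  obtain ⟨z, hz⟩ := h (-y)
  refine ⟨z, ?_⟩
  rw [Submodule.mem_bot, ← sub_eq_zero.2 hz]
  noncomm_ring

theorem exists_one_sub_mul_eq_one {x : S} (hx : x ∈ Ring.jacobson S) :
    ∃ z, (1 - x) * z = 1 := by
  obtain ⟨z, hz⟩ := exists_mul_one_sub_eq_one hx
  have hzx : z * x ∈ Ring.jacobson S := Ideal.mul_mem_left _ _ hx
  obtain ⟨w, hw⟩ := exists_mul_one_sub_eq_one (neg_mem hzx)
  have h1 : 1 - -(z * x) = z := by
    calc 1 - -(z * x) = 1 + z * x := by abel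
      _ = z * (1 - x) + z * x := by rw [hz]
      _ = z := by noncomm_ring
  rw [h1] at hw
  refine ⟨z, ?_⟩
  have : 1 - x = w := by
    calc 1 - x = (w * z) * (1 - x) := by rw [hw, one_mul]
      _ = w := by rw [mul_assoc, hz, mul_one]
  rw [this, hw]

/-- The radical is semiprime. -/
theorem exists_mul_mul_notMem_jacobson {z : S} (hz : z ∉ Ring.jacobson S) :
    ∃ s, z * s * z ∉ Ring.jacobson S := by
  by_contra! h
  refine hz (mem_jacobson_of_forall fun y => ?_)
  obtain ⟨w, hw⟩ := exists_mul_one_sub_eq_one (Ideal.mul_mem_left _ y (h y))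
  refine ⟨w * (1 + y * z), ?_⟩
  calc w * (1 + y * z) * (1 - y * z) = w * (1 - y * (z * y * z)) := by noncomm_ring
    _ = 1 := hw

/-- Since `aS = ann_r(c)`, the element `c` kills `a` from the left, hence also `b`, so `b ∈ aS`.
This converts comparisons of left annihilators into divisibility. -/
theorem IsRightQuasiMorphicRing.exists_mul_eq (h : IsRightQuasiMorphicRing S) {a b : S}
    (hab : leftAnn a ≤ leftAnn b) : ∃ s, a * s = b := by
  obtain ⟨-, c, -, hc⟩ := h a
  rw [rightAnn_eq_rightPrincipal] at hc
  have h1 : c * a = 0 := (hc a).2 ⟨1, mul_one a⟩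
  exact (hc b).1 (hab h1)

theorem leftAnn_le_leftAnn_mul (a s : S) : leftAnn a ≤ leftAnn (a * s) := by
  intro x hx
  rw [mem_leftAnn] at *
  rw [← mul_assoc, hx, zero_mul]

/-- Noetherian induction on `ann_l(a)`, larger annihilators first. If `a ∉ J`, the right ideal `aS`
contains some `e = ay ∉ J` that is idempotent modulo `J`, and `a - aya` has a strictly larger left
annihilator. -/
theorem IsRightQuasiMorphicRing.exists_sub_mem_jacobson [IsNoetherianRing S]
    (h : IsRightQuasiMorphicRing S) (a : S) : ∃ y, a - a * y * a ∈ Ring.jacobson S := by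
  have wf : WellFounded fun a b : S => leftAnn b < leftAnn a :=
    InvImage.wf (leftAnn : S → Submodule S S) (wellFounded_gt (α := Submodule S S))
  induction a using wf.induction with
  | _ a ih =>
  by_cases ha : a ∈ Ring.jacobson S
  · exact ⟨0, by simpa using ha⟩
  -- Among the elements of `aS` outside `J`, `z` has maximal left annihilator; hence every `zt ∉ J`
  -- generates the same right ideal as `z`.
  obtain ⟨z, ⟨⟨x, hx⟩, hzJ⟩, hmin⟩ := wf.has_min
    {z | (∃ x, a * x = z) ∧ z ∉ Ring.jacobson S} ⟨a, ⟨1, mul_one a⟩, ha⟩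
  have key : ∀ w, (∃ t, z * t = w) → w ∉ Ring.jacobson S → ∃ t, w * t = z := by
    rintro _ ⟨t, rfl⟩ hw
    refine h.exists_mul_eq ?_
    by_contra hn
    refine hmin (z * t) ⟨⟨x * t, by rw [← mul_assoc, hx]⟩, hw⟩ ?_
    exact lt_of_le_not_ge (leftAnn_le_leftAnn_mul z t) hn
  obtain ⟨s, hs⟩ := exists_mul_mul_notMem_jacobson hzJ
  obtain ⟨t, ht⟩ := key (z * s * z) ⟨s * z, by rw [mul_assoc]⟩ hs
  have hpe : z * s * (z * t * s) = z * s := by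
    calc z * s * (z * t * s) = (z * s * z * t) * s := by noncomm_ring
      _ = z * s := by rw [ht]
  set e := z * t * s with he
  have heJ : e ∉ Ring.jacobson S := fun hJ => hs <| by
    rw [← hpe]
    exact Ideal.mul_mem_right _ _ (Ideal.mul_mem_left _ _ hJ)
  have hee : e * e - e ∈ Ring.jacobson S := by
    by_contra hn
    obtain ⟨r, hr⟩ := key (e * e - e) ⟨t * s * e - t * s, by rw [he]; noncomm_ring⟩ hn
    refine hs ?_
    have : z * s * z = 0 := by
      calc z * s * z = z * s * ((e * e - e) * r) := by rw [hr]
        _ = (z * s * e * e - z * s * e) * r := by noncomm_ring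
        _ = 0 := by rw [hpe, hpe, sub_self, zero_mul]
    rw [this]
    exact zero_mem _
  set y := x * t * s with hy
  have hay : a * y = e := by rw [hy, he, ← hx]; noncomm_ring
  -- If the annihilator did not grow, then `a ∈ (1 - ay)aS`, so `e ∈ (1 - e)S`; as `e` is idempotent
  -- modulo `J`, this would put `e` in `J`.
  obtain ⟨y', hy'⟩ := ih (a * (1 - y * a)) <| by
    refine lt_of_le_not_ge (leftAnn_le_leftAnn_mul _ _) fun hle => heJ ?_
    obtain ⟨r, hr⟩ := h.exists_mul_eq hle
    have h1 : e = (1 - e) * (a * r * y) := by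
      calc e = a * y := hay.symm
        _ = a * (1 - y * a) * r * y := by rw [hr]
        _ = (1 - a * y) * (a * r * y) := by noncomm_ring
        _ = _ := by rw [hay]
    have h2 : e = -(e * e - e) * (1 + a * r * y) := by
      have h3 : e * e = (e - e * e) * (a * r * y) := by
        calc e * e = e * ((1 - e) * (a * r * y)) := by rw [← h1]
          _ = _ := by noncomm_ring
      calc e = (e - e * e) + e * e := by abel
        _ = (e - e * e) + (e - e * e) * (a * r * y) := by rw [← h3]
        _ = _ := by noncomm_ring
    rw [h2]
    exact Ideal.mul_mem_right _ _ (neg_mem hee)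
  -- McCoy's identity: with `a' = a - aya`, this choice leaves the error `a' - a'y'a'`.
  refine ⟨y + (1 - y * a) * y' * (1 - a * y), ?_⟩
  convert hy' using 1
  noncomm_ring

/-- The chain `ann_l(j ^ n)` stabilizes, so `j ^ n = j ^ (n + 1) s`, that is, `j ^ n (1 - js) = 0`
with `1 - js` right invertible. -/
theorem exists_pow_eq_zero_of_mem_jacobson [IsNoetherianRing S]
    (h : IsRightQuasiMorphicRing S) {j : S} (hj : j ∈ Ring.jacobson S) : ∃ n, j ^ n = 0 := by
  obtain ⟨n, hn⟩ := monotone_stabilizes_iff_noetherian.2 ‹IsNoetherianRing S›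
    ⟨fun n => leftAnn (j ^ n), monotone_nat_of_le_succ fun n => by
      rw [pow_succ]; exact leftAnn_le_leftAnn_mul _ _⟩
  have h1 : leftAnn (j ^ (n + 1)) ≤ leftAnn (j ^ n) := (hn (n + 1) (Nat.le_succ n)).ge
  obtain ⟨s, hs⟩ := h.exists_mul_eq h1
  obtain ⟨w, hw⟩ := exists_one_sub_mul_eq_one (Ideal.mul_mem_right s _ hj)
  refine ⟨n, ?_⟩
  calc j ^ n = j ^ n * ((1 - j * s) * w) := by rw [hw, mul_one]
    _ = (j ^ n - j ^ (n + 1) * s) * w := by rw [pow_succ]; noncomm_ring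
    _ = 0 := by rw [hs, sub_self, zero_mul]

/-- As `K = Sj` is two-sided, `jS ⊆ Sj`, so all factors `j` can be moved to the right and `K ^ m ⊆ S
j ^ m`. -/
theorem isNilpotent_of_span_singleton {K : Ideal S} [K.IsTwoSided] {j : S}
    (hK : K = Ideal.span {j}) {n : ℕ} (hn : j ^ n = 0) : IsNilpotent K := by
  have key : ∀ m, K ^ m ≤ Ideal.span {j ^ m} := by
    intro m
    induction m with
    | zero => simp
    | succ m ih =>
      rw [Submodule.pow_succ, Ideal.mul_le]
      intro r hr s hs
      obtain ⟨a, rfl⟩ := Ideal.mem_span_singleton'.1 (ih hr)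
      rw [hK] at hs
      obtain ⟨b, rfl⟩ := Ideal.mem_span_singleton'.1 hs
      have hjK : j ∈ K := hK ▸ Ideal.mem_span_singleton_self j
      have comm : ∀ i b, ∃ c, j ^ i * b = c * j ^ i := by
        intro i
        induction i with
        | zero => exact fun b => ⟨b, by simp⟩
        | succ i ih =>
          intro b
          have h1 : j * b ∈ Ideal.span {j} := hK ▸ Ideal.mul_mem_right b K hjK
          obtain ⟨c, hc⟩ := Ideal.mem_span_singleton'.1 h1
          obtain ⟨d, hd⟩ := ih c
          exact ⟨d, by rw [pow_succ, mul_assoc, ← hc, ← mul_assoc, hd, mul_assoc]⟩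
      obtain ⟨c, hc⟩ := comm m b
      refine Ideal.mem_span_singleton'.2 ⟨a * c, ?_⟩
      rw [pow_succ, mul_assoc a, ← mul_assoc c, ← hc]
      noncomm_ring
  refine ⟨n, ?_⟩
  rw [Submodule.zero_eq_bot, eq_bot_iff]
  refine (key n).trans ?_
  rw [hn]
  simp

/-- A ring all of whose left ideals are principal and all of whose elements are von Neumann
regular is semisimple. -/
theorem isSemisimpleRing_of_regular (hP : ∀ I : Ideal S, I.IsPrincipal)
    (h : ∀ a : S, ∃ y, a * y * a = a) : IsSemisimpleRing S := by
  refine { exists_isCompl := fun I => ?_ }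
  obtain ⟨a, rfl⟩ := hP I
  obtain ⟨y, hy⟩ := h a
  have hf : y * a * (y * a) = y * a := by rw [mul_assoc, ← mul_assoc a, hy]
  refine ⟨Submodule.span S {1 - y * a}, ?_⟩
  rw [isCompl_iff, Submodule.disjoint_def, codisjoint_iff, Ideal.eq_top_iff_one]
  constructor
  · intro x hx hx'
    obtain ⟨p, rfl⟩ := Submodule.mem_span_singleton.1 hx
    obtain ⟨q, hq⟩ := Submodule.mem_span_singleton.1 hx'
    rw [smul_eq_mul, smul_eq_mul] at hq
    have h1 : p * a = p * a * (y * a) := by rw [mul_assoc p, ← mul_assoc a, hy]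
    rw [smul_eq_mul, h1, ← hq, mul_assoc, sub_mul, one_mul, hf, sub_self, mul_zero]
  · rw [Submodule.mem_sup]
    exact ⟨y * a, Submodule.mem_span_singleton.2 ⟨y, rfl⟩, 1 - y * a,
      Submodule.mem_span_singleton_self _, by abel⟩

theorem IsQuasiMorphicRing.forall_isPrincipal (h : IsQuasiMorphicRing S)
    [IsNoetherianRing S] (I : Ideal S) : I.IsPrincipal :=
  isPrincipal_of_fg_of_sup (fun _ _ => h.1.sup_isPrincipal) (IsNoetherian.noetherian I)

theorem IsQuasiMorphicRing.isArtinianRing (h : IsQuasiMorphicRing S)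
    [IsNoetherianRing S] : IsArtinianRing S := by
  have : IsSemiprimaryRing S := by
    refine ⟨isSemisimpleRing_of_regular (forall_isPrincipal_of_surjective
      (Ideal.Quotient.mk (Ring.jacobson S)) Ideal.Quotient.mk_surjective h.forall_isPrincipal)
      fun a => ?_, ?_⟩
    · obtain ⟨a, rfl⟩ := Ideal.Quotient.mk_surjective a
      obtain ⟨y, hy⟩ := h.2.exists_sub_mem_jacobson a
      refine ⟨Ideal.Quotient.mk _ y, ?_⟩
      rw [← map_mul, ← map_mul]
      exact (Ideal.Quotient.eq.2 hy).symm
    · obtain ⟨j, hj⟩ := h.forall_isPrincipal (Ring.jacobson S)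
      obtain ⟨n, hn⟩ := exists_pow_eq_zero_of_mem_jacobson h.2
        (hj ▸ Submodule.mem_span_singleton_self j)
      exact isNilpotent_of_span_singleton hj hn
  exact IsSemiprimaryRing.isNoetherian_iff_isArtinian.1 ‹_›

/-- The map `aS ↦ ann_l(a)` strictly reverses inclusion, so the descending chain condition on left
ideals gives the ascending one on principal right ideals. -/
theorem IsQuasiMorphicRing.op_isNoetherianRing (h : IsQuasiMorphicRing S)
    [IsArtinianRing S] : IsNoetherianRing Sᵐᵒᵖ := by
  refine isNoetherianRing_of_accPrincipalLeftIdeals (fun _ _ => h.op.1.sup_isPrincipal) ?_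
  let g : {I : Submodule Sᵐᵒᵖ Sᵐᵒᵖ // I.IsPrincipal} → Submodule S S := fun I =>
    leftAnn (unop I.2.1.choose)
  have hg : ∀ I J, I < J → g J < g I := by
    intro I J hIJ
    have hI := I.2.1.choose_spec
    have hJ := J.2.1.choose_spec
    set a := I.2.1.choose
    set b := J.2.1.choose
    have h1 : ∀ x y : Sᵐᵒᵖ, Submodule.span Sᵐᵒᵖ {x} ≤ Submodule.span Sᵐᵒᵖ {y} ↔
        leftAnn (unop y) ≤ leftAnn (unop x) := by
      intro x y
      rw [Submodule.span_singleton_le_iff_mem, Submodule.mem_span_singleton]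
      constructor
      · rintro ⟨c, rfl⟩
        exact leftAnn_le_leftAnn_mul _ _
      · intro hle
        obtain ⟨s, hs⟩ := h.2.exists_mul_eq hle
        exact ⟨MulOpposite.op s, unop_injective hs⟩
    rw [← Subtype.coe_lt_coe, hI, hJ, lt_iff_le_not_ge, h1, h1] at hIJ
    exact lt_iff_le_not_ge.2 hIJ
  exact ⟨Subrelation.wf (fun {I J} hIJ => hg J I hIJ)
    (InvImage.wf g (wellFounded_lt (α := Submodule S S)))⟩

/-- A left noetherian quasi-morphic ring is an artinian principal ring. -/
theorem IsQuasiMorphicRing.isTwoSidedArtinianRing_and_isPrincipalRing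
    (h : IsQuasiMorphicRing S) [IsNoetherianRing S] :
    IsTwoSidedArtinianRing S ∧ IsPrincipalRing S := by
  have hl := h.isArtinianRing
  have hr := h.op_isNoetherianRing
  exact ⟨isTwoSidedArtinianRing_iff.2 ⟨h.isArtinianRing, h.op.isArtinianRing⟩,
    isPrincipalRing_iff.2 ⟨h.forall_isPrincipal, h.op.forall_isPrincipal⟩⟩

end Artinian

/-! ### Idempotents central modulo a nilpotent ideal -/

section CentralIdempotents

variable {A : Type u} [Ring A]

theorem isNilpotent_of_mem_isNilpotent {K : Ideal A} (hK : IsNilpotent K) {x : A}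
    (hx : x ∈ K) : IsNilpotent x := by
  obtain ⟨n, hn⟩ := hK
  have key : ∀ m, x ^ m ∈ K ^ m := by
    intro m
    induction m with
    | zero => simp [Submodule.pow_zero, Ideal.one_eq_top]
    | succ m ih =>
      rw [pow_succ, Submodule.pow_succ]
      exact Ideal.mul_mem_mul ih hx
  refine ⟨n, ?_⟩
  have := key n
  rwa [hn] at this

/-- The Peirce component `eA(1 - e)` lies in `K`. Principality of one left ideal shows that each of
its elements is a product of two elements of `K`, and this improvement iterates until `K ^ m = 0`.
-/
theorem peirce_eq_zero [IsNoetherianRing A] (hP : ∀ I : Ideal A, I.IsPrincipal)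
    {K : Ideal A} [K.IsTwoSided] (hK : IsNilpotent K) {e : A} (he : e * e = e)
    (hc : ∀ x, e * x - x * e ∈ K) (x : A) : e * x * (1 - e) = 0 := by
  have hc' : ∀ x, e * x * (1 - e) ∈ K := fun x => by
    have : e * x * (1 - e) = e * (e * x - x * e) := by
      rw [mul_sub, mul_sub, ← mul_assoc, ← mul_assoc, he, mul_one]
    rw [this]
    exact Ideal.mul_mem_left _ _ (hc x)
  have prod : ∀ x, ∃ p ∈ K, ∃ q ∈ K, e * x * (1 - e) = p * q := by
    intro x
    -- With `I = Aa`, write `e = ta` and `ex(1 - e) = sa`. The aim is `es ∈ K`, since `a(1 - e) ∈ K`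
    -- already holds.
    let I : Ideal A :=
      { carrier := {z | z * (1 - e) ∈ K}
        add_mem' := fun {p q} hp hq => by
          change (p + q) * (1 - e) ∈ K
          rw [add_mul]
          exact add_mem hp hq
        zero_mem' := by simp
        smul_mem' := fun c p hp => by
          change c * p * (1 - e) ∈ K
          rw [mul_assoc]
          exact Ideal.mul_mem_left _ _ hp }
    obtain ⟨a, ha⟩ := hP I
    have haI : a * (1 - e) ∈ K := by
      have : a ∈ I := ha ▸ Submodule.mem_span_singleton_self a
      exact this
    have heI : e ∈ I := by
      change e * (1 - e) ∈ K
      rw [mul_sub, mul_one, he, sub_self]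
      exact zero_mem _
    have hee : (1 - e) * (1 - e) = 1 - e := by
      rw [mul_sub, mul_one, sub_mul, one_mul, he, sub_self, sub_zero]
    have hyI : e * x * (1 - e) ∈ I := by
      change e * x * (1 - e) * (1 - e) ∈ K
      rw [mul_assoc, hee]
      exact hc' x
    rw [ha, Submodule.mem_span_singleton] at heI hyI
    obtain ⟨t, ht⟩ := heI
    obtain ⟨s, hs⟩ := hyI
    rw [smul_eq_mul] at ht hs
    -- `eae` is a unit of `eAe`: `ete` inverts it on the left up to a nilpotent error, and a left
    -- noetherian ring is Dedekind finite. Adding `1 - e` expresses this inside `A`.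
    have hu : (e * t * e + (1 - e)) * (e * a * e + (1 - e)) =
        1 - e * t * (1 - e) * (a * e) := by
      have h1 : e * t * e * (e * a * e) = e - e * t * (1 - e) * (a * e) := by
        calc e * t * e * (e * a * e) = e * t * (e * e) * a * e := by noncomm_ring
          _ = e * (t * a) * e - e * t * (1 - e) * (a * e) := by rw [he]; noncomm_ring
          _ = _ := by rw [ht, he, he]
      have h2 : e * t * e * (1 - e) = 0 := by
        rw [mul_sub, mul_one, mul_assoc (e * t) e e, he, sub_self]
      have h3 : (1 - e) * (e * a * e) = 0 := by
        rw [← mul_assoc, ← mul_assoc, sub_mul, one_mul, he, sub_self, zero_mul, zero_mul]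
      rw [add_mul, mul_add, mul_add, h1, h2, h3, hee]
      abel
    have hunit : IsUnit (1 - e * t * (1 - e) * (a * e)) :=
      (isNilpotent_of_mem_isNilpotent hK (Ideal.mul_mem_right _ _ (hc' t))).isUnit_one_sub
    rw [← hu] at hunit
    obtain ⟨w, hw⟩ := hunit.exists_left_inv
    obtain ⟨v, hv⟩ : ∃ v, (e * a * e + (1 - e)) * v = 1 :=
      ⟨w * (e * t * e + (1 - e)), mul_eq_one_symm (by rw [mul_assoc, hw])⟩
    have hsae : s * a * e = 0 := by
      rw [hs, mul_assoc, sub_mul, one_mul, he, sub_self, mul_zero]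
    have hese : e * s * e ∈ K := by
      have h1 : e * s * e * (e * a * e + (1 - e)) = -(e * s * (1 - e) * (a * e)) := by
        calc e * s * e * (e * a * e + (1 - e))
            = e * s * (e * e) * a * e + (e * s * e - e * s * (e * e)) := by noncomm_ring
          _ = e * (s * a * e) - e * s * (1 - e) * (a * e) := by rw [he]; noncomm_ring
          _ = _ := by rw [hsae, mul_zero, zero_sub]
      have h2 : e * s * e = -(e * s * (1 - e) * (a * e)) * v := by
        rw [← h1, mul_assoc (e * s * e), hv, mul_one]
      rw [h2]
      exact Ideal.mul_mem_right _ _ (neg_mem (Ideal.mul_mem_right _ _ (hc' s)))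
    have hes : e * s ∈ K := by
      have : e * s = e * s * e + e * s * (1 - e) := by noncomm_ring
      rw [this]
      exact add_mem hese (hc' s)
    refine ⟨e * s, hes, a * (1 - e), haI, ?_⟩
    calc e * x * (1 - e) = e * (e * x * (1 - e)) * (1 - e) := by
          rw [← mul_assoc, ← mul_assoc, he, mul_assoc _ (1 - e), hee]
      _ = e * (s * a) * (1 - e) := by rw [hs]
      _ = _ := by noncomm_ring
  have key : ∀ m x, e * x * (1 - e) ∈ K ^ m := by
    intro m
    induction m with
    | zero => simp [Submodule.pow_zero, Ideal.one_eq_top]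
    | succ m ih =>
      intro x
      obtain ⟨p, hp, q, hq, hpq⟩ := prod x
      have hee : (1 - e) * (1 - e) = 1 - e := by
        rw [mul_sub, mul_one, sub_mul, one_mul, he, sub_self, sub_zero]
      -- Inserting `1 = e + (1 - e)` between `p` and `q` puts a Peirce component, known to lie in `K
      -- ^ m`, into each summand.
      have : e * x * (1 - e) = e * p * (e * q * (1 - e)) + e * p * (1 - e) * (q * (1 - e)) := by
        calc e * x * (1 - e) = e * (e * x * (1 - e)) * (1 - e) := by
              rw [← mul_assoc, ← mul_assoc, he, mul_assoc _ (1 - e), hee]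
          _ = _ := by rw [hpq]; noncomm_ring
      rw [this]
      refine add_mem ?_ ?_
      · rw [Ideal.IsTwoSided.pow_succ]
        exact Ideal.mul_mem_mul (Ideal.mul_mem_left _ _ hp) (ih q)
      · rw [Submodule.pow_succ]
        exact Ideal.mul_mem_mul (ih p) (Ideal.mul_mem_right _ _ hq)
  obtain ⟨n, hn⟩ := hK
  have := key n x
  rwa [hn] at this

/-- Over a left noetherian ring with principal left ideals, an idempotent that is central modulo
a nilpotent ideal is central. -/
theorem commute_of_idempotent [IsNoetherianRing A] (hP : ∀ I : Ideal A, I.IsPrincipal)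
    {K : Ideal A} [K.IsTwoSided] (hK : IsNilpotent K) {e : A} (he : e * e = e)
    (hc : ∀ x, e * x - x * e ∈ K) (x : A) : e * x = x * e := by
  have h1 := peirce_eq_zero hP hK he hc x
  have h2 := peirce_eq_zero hP hK (e := 1 - e)
    (by rw [mul_sub, mul_one, sub_mul, one_mul, he, sub_self, sub_zero])
    (fun x => by
      have : (1 - e) * x - x * (1 - e) = -(e * x - x * e) := by noncomm_ring
      rw [this]
      exact neg_mem (hc x)) x
  rw [sub_sub_cancel] at h2
  calc e * x = e * x * (1 - e) + e * x * e := by noncomm_ring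
    _ = (1 - e) * x * e + e * x * e := by rw [h1, h2]
    _ = x * e := by noncomm_ring

end CentralIdempotents

/-! ### Nilpotence criteria -/

section Nilpotent

/-- Bounds `K ^ m` by sets `F m` that may be described in another ring, such as the opposite ring or
an ambient ring of a corner. -/
theorem isNilpotent_of_filtration {B : Type*} [Ring B] {K : Ideal B} (F : ℕ → Set B) (n : ℕ)
    (h0 : ∀ x, x ∈ F 0) (hadd : ∀ m x y, x ∈ F m → y ∈ F m → x + y ∈ F m)
    (hmul : ∀ m x y, x ∈ F m → y ∈ K → x * y ∈ F (m + 1)) (hn : ∀ x ∈ F n, x = 0) :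
    IsNilpotent K := by
  have key : ∀ m, ∀ x ∈ K ^ m, x ∈ F m := by
    intro m
    induction m with
    | zero => exact fun x _ => h0 x
    | succ m ih =>
      intro x hx
      rw [Submodule.pow_succ] at hx
      exact Submodule.mul_induction_on hx (fun r hr s hs => hmul m r s (ih r hr) hs)
        (hadd (m + 1))
  refine ⟨n, ?_⟩
  rw [Submodule.zero_eq_bot, eq_bot_iff]
  exact fun x hx => hn x (key n x hx)

theorem isNilpotent_ker_op {B D : Type*} [Ring B] [Ring D] (g : B →+* D)
    (hK : IsNilpotent (RingHom.ker g)) : IsNilpotent (RingHom.ker g.op) := by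
  obtain ⟨n, hn⟩ := hK
  refine isNilpotent_of_filtration (fun m => {x | unop x ∈ RingHom.ker g ^ m}) n
    (fun x => ?_) (fun m x y hx hy => ?_) (fun m x y hx hy => ?_) (fun x hx => ?_)
  · change unop x ∈ RingHom.ker g ^ 0
    simp [Submodule.pow_zero, Ideal.one_eq_top]
  · exact add_mem (S := Ideal B) (s := RingHom.ker g ^ m) hx hy
  · change unop y * unop x ∈ RingHom.ker g ^ (m + 1)
    rw [Ideal.IsTwoSided.pow_succ]
    exact Ideal.mul_mem_mul ((op_eq_zero_iff _).1 hy) hx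
  · change unop x ∈ RingHom.ker g ^ n at hx
    rw [hn] at hx
    exact unop_injective hx

end Nilpotent

/-! ### Corner rings -/

section Corner

variable {A : Type u} [Ring A] {e : A}

/-- The inclusion of a corner ring. -/
def cornerVal (h : IsIdempotentElem e) : h.Corner →+ A where
  toFun := fun x => x.1
  map_zero' := rfl
  map_add' := fun _ _ => rfl

/-- The element of the corner ring given by an element `x` with `e x = x = x e`. -/
def cornerMk (h : IsIdempotentElem e) (x : A) (h1 : e * x = x) (h2 : x * e = x) : h.Corner :=
  ⟨x, (Subsemigroup.mem_corner_iff h).2 ⟨h1, h2⟩⟩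

variable (h : IsIdempotentElem e)

theorem cornerVal_injective : Function.Injective (cornerVal h) := Subtype.val_injective

@[simp] theorem cornerVal_cornerMk (x : A) (h1 h2) : cornerVal h (cornerMk h x h1 h2) = x := rfl

@[simp] theorem cornerVal_mul (x y : h.Corner) :
    cornerVal h (x * y) = cornerVal h x * cornerVal h y := rfl

@[simp] theorem cornerVal_one : cornerVal h 1 = e := rfl

theorem mul_cornerVal (x : h.Corner) : e * cornerVal h x = cornerVal h x :=
  ((Subsemigroup.mem_corner_iff h).1 x.2).1

theorem cornerVal_mul_idem (x : h.Corner) : cornerVal h x * e = cornerVal h x :=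
  ((Subsemigroup.mem_corner_iff h).1 x.2).2

theorem isNilpotent_ker_corner {D : Type*} [Ring D] (g : h.Corner →+* D) {K : Ideal A}
    (hK : IsNilpotent K) (hg : ∀ t, g t = 0 → cornerVal h t ∈ K) :
    IsNilpotent (RingHom.ker g) := by
  obtain ⟨n, hn⟩ := hK
  refine isNilpotent_of_filtration (fun m => {x | cornerVal h x ∈ K ^ m}) n
    (fun x => ?_) (fun m x y hx hy => ?_) (fun m x y hx hy => ?_) (fun x hx => ?_)
  · change cornerVal h x ∈ K ^ 0
    simp [Submodule.pow_zero, Ideal.one_eq_top]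
  · change cornerVal h (x + y) ∈ K ^ m
    rw [map_add]
    exact add_mem hx hy
  · change cornerVal h x * cornerVal h y ∈ K ^ (m + 1)
    rw [Submodule.pow_succ]
    exact Ideal.mul_mem_mul hx (hg y hy)
  · change cornerVal h x ∈ K ^ n at hx
    rw [hn] at hx
    exact cornerVal_injective h (hx.trans (map_zero _).symm)

end Corner

/-! ### Lifting matrix units -/

section MatrixUnits

variable {A : Type u} [Ring A] {ι : Type*} [Fintype ι] [DecidableEq ι]

/-- A ring with a full system of matrix units is a matrix ring over a corner. -/
theorem exists_ringEquiv_matrix_corner {e : ι → A} (he : CompleteOrthogonalIdempotents e) (o : ι)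
    (a b : ι → A) (ha : ∀ i, a i * e i = a i) (ha' : ∀ i, e o * a i = a i)
    (hb : ∀ i, e i * b i = b i) (hb' : ∀ i, b i * e o = b i)
    (hab : ∀ i, a i * b i = e o) (hba : ∀ i, b i * a i = e i) :
    Nonempty (A ≃+* Matrix ι ι (he.idem o).Corner) := by
  have horth : ∀ i j, i ≠ j → a i * b j = 0 := fun i j hij => by
    rw [← ha, ← hb, mul_assoc, ← mul_assoc (e i), he.ortho hij, zero_mul, mul_zero]
  have hm1 : ∀ x i j, e o * (a i * x * b j) = a i * x * b j := fun x i j => by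
    rw [← mul_assoc, ← mul_assoc, ha']
  have hm2 : ∀ x i j, a i * x * b j * e o = a i * x * b j := fun x i j => by
    rw [mul_assoc, hb']
  let F : A → Matrix ι ι (he.idem o).Corner := fun x =>
    Matrix.of fun i j => cornerMk (he.idem o) (a i * x * b j) (hm1 x i j) (hm2 x i j)
  have hF : ∀ x i j, cornerVal (he.idem o) (F x i j) = a i * x * b j := fun _ _ _ => rfl
  have hinj := cornerVal_injective (he.idem o)
  let φ : A →+* Matrix ι ι (he.idem o).Corner :=
    { toFun := F
      map_one' := by
        ext i j
        apply hinj
        rw [hF, mul_one, Matrix.one_apply]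
        split_ifs with h
        · rw [h, hab, cornerVal_one]
        · rw [horth i j h, map_zero]
      map_zero' := by
        ext i j
        apply hinj
        rw [hF, mul_zero, zero_mul, Matrix.zero_apply, map_zero]
      map_add' := fun x y => by
        ext i j
        apply hinj
        rw [Matrix.add_apply, map_add, hF, hF, hF, mul_add, add_mul]
      map_mul' := fun x y => by
        ext i j
        apply hinj
        rw [hF, Matrix.mul_apply, map_sum]
        calc a i * (x * y) * b j = a i * x * (∑ k, e k) * (y * b j) := by
              rw [he.complete]; noncomm_ring
          _ = ∑ k, a i * x * e k * (y * b j) := by rw [Finset.mul_sum, Finset.sum_mul]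
          _ = _ := Finset.sum_congr rfl fun k _ => by
            rw [cornerVal_mul, hF, hF, ← hba k]
            noncomm_ring }
  have hφ : ∀ x i j, cornerVal (he.idem o) (φ x i j) = a i * x * b j := fun _ _ _ => rfl
  refine ⟨RingEquiv.ofBijective φ ⟨?_, fun t => ?_⟩⟩
  · rw [injective_iff_map_eq_zero]
    intro x hx
    have h0 : ∀ i j, a i * x * b j = 0 := fun i j => by
      rw [← hφ, hx, Matrix.zero_apply, map_zero]
    calc x = (∑ i, e i) * x * ∑ j, e j := by rw [he.complete]; noncomm_ring
      _ = ∑ i, ∑ j, e i * x * e j := by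
          rw [Finset.sum_mul, Finset.sum_mul]
          exact Finset.sum_congr rfl fun i _ => Finset.mul_sum _ _ _
      _ = 0 := Finset.sum_eq_zero fun i _ => Finset.sum_eq_zero fun j _ => by
          rw [← hba i, ← hba j]
          calc b i * a i * x * (b j * a j) = b i * (a i * x * b j) * a j := by noncomm_ring
            _ = 0 := by rw [h0, mul_zero, zero_mul]
  · refine ⟨∑ i, ∑ j, b i * cornerVal (he.idem o) (t i j) * a j, ?_⟩
    ext k l
    apply hinj
    rw [hφ, Finset.mul_sum, Finset.sum_mul, Finset.sum_eq_single k, Finset.mul_sum,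
      Finset.sum_mul, Finset.sum_eq_single l]
    · calc a k * (b k * cornerVal (he.idem o) (t k l) * a l) * b l = (a k * b k) * cornerVal (he.idem o) (t k l) * (a l * b l) := by
            noncomm_ring
        _ = cornerVal (he.idem o) (t k l) := by rw [hab, hab, mul_cornerVal, cornerVal_mul_idem]
    · intro j _ hj
      calc a k * (b k * cornerVal (he.idem o) (t k j) * a j) * b l = a k * b k * cornerVal (he.idem o) (t k j) * (a j * b l) := by
            noncomm_ring
        _ = 0 := by rw [horth j l hj, mul_zero]
    · simp
    · intro i _ hi
      rw [Finset.mul_sum, Finset.sum_mul]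
      refine Finset.sum_eq_zero fun j _ => ?_
      calc a k * (b i * cornerVal (he.idem o) (t i j) * a j) * b l = a k * b i * (cornerVal (he.idem o) (t i j) * (a j * b l)) := by
            noncomm_ring
        _ = 0 := by rw [horth k i (Ne.symm hi), zero_mul]
    · simp

theorem completeOrthogonalIdempotents_single (D : Type*) [Ring D] :
    CompleteOrthogonalIdempotents fun i : ι => Matrix.single i i (1 : D) where
  idem i := by simp [IsIdempotentElem]
  ortho i j hij := by simp [hij]
  complete := Matrix.sum_single_one

/-- A ring that maps onto a matrix ring over `D` with nilpotent kernel is a matrix ring over a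
ring that maps onto `D` with nilpotent kernel. -/
theorem exists_ringEquiv_matrix_of_surjective [Nonempty ι] {D : Type*} [Ring D]
    (f : A →+* Matrix ι ι D) (hf : Function.Surjective f) (hK : IsNilpotent (RingHom.ker f)) :
    ∃ (T : Type u) (_ : Ring T) (g : T →+* D), Nonempty (A ≃+* Matrix ι ι T) ∧
      Function.Surjective g ∧ IsNilpotent (RingHom.ker g) := by
  have hnil : ∀ x ∈ RingHom.ker f, IsNilpotent x := fun x hx =>
    isNilpotent_of_mem_isNilpotent hK hx
  obtain ⟨e, he, hfe⟩ := CompleteOrthogonalIdempotents.lift_of_isNilpotent_ker f hnil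
    (completeOrthogonalIdempotents_single (ι := ι) D) fun i => hf _
  have hfe : ∀ i, f (e i) = Matrix.single i i 1 := fun i => congrFun hfe i
  let o : ι := Classical.arbitrary ι
  have units : ∀ i, ∃ a b, a * e i = a ∧ e o * a = a ∧ e i * b = b ∧ b * e o = b ∧
      a * b = e o ∧ b * a = e i := by
    intro i
    obtain ⟨a', ha'⟩ := hf (Matrix.single o i 1)
    obtain ⟨b', hb'⟩ := hf (Matrix.single i o 1)
    have hei : e i * e i = e i := he.idem i
    have heo : e o * e o = e o := he.idem o
    -- The lifts `a'`, `b'` of the off-diagonal units multiply to `e o` only up to the nilpotent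
    -- `z`; inserting `w = (1 - z)⁻¹` into `b` makes the product exact.
    set z := e o - e o * a' * e i * b' * e o with hz
    have hzK : z ∈ RingHom.ker f := by
      rw [RingHom.mem_ker, hz]
      simp [hfe, ha', hb']
    obtain ⟨w, hw⟩ := (hnil z hzK).isUnit_one_sub.exists_right_inv
    have hfw : f w = 1 := by
      have := congrArg f hw
      rwa [map_mul, map_sub, (RingHom.mem_ker).1 hzK, map_one, sub_zero, one_mul] at this
    have hab : e o * a' * e i * (e i * b' * e o * w * e o) = e o := by
      calc e o * a' * e i * (e i * b' * e o * w * e o)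
          = e o * a' * (e i * e i) * b' * e o * w * e o := by noncomm_ring
        _ = (e o * e o - z) * w * e o := by rw [hei, hz, heo]; noncomm_ring
        _ = (e o * e o - e o * z) * w * e o := by
            congr 3
            rw [hz, mul_sub, heo]
            congr 1
            simp only [← mul_assoc, heo]
        _ = e o * ((1 - z) * w) * e o + (e o * e o - e o) * w * e o := by noncomm_ring
        _ = e o := by rw [hw, heo, mul_one, heo, sub_self, zero_mul, zero_mul, add_zero]
    have h1 : e o * a' * e i * e i = e o * a' * e i := by rw [mul_assoc, hei]
    have h2 : e o * (e o * a' * e i) = e o * a' * e i := by simp only [← mul_assoc, heo]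
    have h3 : e i * (e i * b' * e o * w * e o) = e i * b' * e o * w * e o := by
      simp only [← mul_assoc, hei]
    have h4 : e i * b' * e o * w * e o * e o = e i * b' * e o * w * e o := by
      rw [mul_assoc, heo]
    refine ⟨e o * a' * e i, e i * b' * e o * w * e o, h1, h2, h3, h4, hab, ?_⟩
    have hfba : f (e i * b' * e o * w * e o * (e o * a' * e i)) = Matrix.single i i 1 := by
      simp [hfe, ha', hb', hfw]
    generalize e o * a' * e i = a at *
    generalize e i * b' * e o * w * e o = b at *
    -- The opposite product needs no further correction: `e i - b * a` is both nilpotent and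
    -- idempotent, hence zero.
    have hk : IsNilpotent (e i - b * a) := hnil _ <| by
      rw [RingHom.mem_ker, map_sub, hfba, hfe, sub_self]
    have hid : IsIdempotentElem (e i - b * a) := by
      calc (e i - b * a) * (e i - b * a)
          = e i * e i - e i * b * a - b * (a * e i) + b * (a * b) * a := by noncomm_ring
        _ = e i - b * a - b * a + b * (e o * a) := by rw [hei, h3, h1, hab]; noncomm_ring
        _ = e i - b * a := by rw [h2]; noncomm_ring
    have h0 : e i - b * a = 0 := by
      obtain ⟨n, hn⟩ := hk
      have := hid.pow_succ_eq n
      rwa [pow_succ, hn, zero_mul, eq_comm] at this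
    exact (sub_eq_zero.1 h0).symm
  choose a b ha ha' hb hb' hab hba using units
  set val := cornerVal (he.idem o) with hval
  have hcor : ∀ t : (he.idem o).Corner, ∀ i j, (i ≠ o ∨ j ≠ o) → f (val t) i j = 0 := by
    intro t i j hij
    have h1 : f (val t) = Matrix.single o o 1 * f (val t) * Matrix.single o o 1 := by
      rw [← hfe, ← map_mul, ← map_mul, mul_cornerVal, cornerVal_mul_idem]
    rw [h1]
    rcases hij with h | h
    · rw [mul_assoc, Matrix.single_mul_apply_of_ne _ _ _ _ _ h]
    · rw [Matrix.mul_single_apply_of_ne _ _ _ _ _ h]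
  let g : (he.idem o).Corner →+* D :=
    { toFun := fun t => f (val t) o o
      map_one' := by rw [hval, cornerVal_one, hfe, Matrix.single_apply_same]
      map_zero' := by rw [map_zero, map_zero, Matrix.zero_apply]
      map_add' := fun s t => by rw [map_add, map_add, Matrix.add_apply]
      map_mul' := fun s t => by
        rw [hval, cornerVal_mul, map_mul, Matrix.mul_apply, Finset.sum_eq_single o]
        · intro k _ hk
          rw [← hval, hcor t k o (Or.inl hk), mul_zero]
        · simp }
  have hg : ∀ t, g t = f (val t) o o := fun _ => rfl
  refine ⟨_, inferInstance, g, exists_ringEquiv_matrix_corner he o a b ha ha' hb hb' hab hba,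
    fun c => ?_, ?_⟩
  · obtain ⟨x, hx⟩ := hf (Matrix.single o o c)
    have heo : e o * e o = e o := he.idem o
    refine ⟨cornerMk (he.idem o) (e o * x * e o) (by simp only [← mul_assoc, heo])
      (by rw [mul_assoc, heo]), ?_⟩
    rw [hg, hval, cornerVal_cornerMk, map_mul, map_mul, hx, hfe]
    simp
  · refine isNilpotent_ker_corner (he.idem o) g hK fun t ht => ?_
    rw [RingHom.mem_ker]
    ext i j
    by_cases h : i ≠ o ∨ j ≠ o
    · rw [← hval, hcor t i j h, Matrix.zero_apply]
    · push Not at h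
      rw [h.1, h.2, ← hval, ← hg, ht, Matrix.zero_apply]

end MatrixUnits

/-! ### The maximal ideal of the local ring is principal -/

section Local

variable {T : Type u} [Ring T]

theorem isUnit_of_notMem_ker {D : Type*} [DivisionRing D] (g : T →+* D)
    (hg : Function.Surjective g) (hK : IsNilpotent (RingHom.ker g)) {t : T} (ht : g t ≠ 0) :
    IsUnit t := by
  obtain ⟨s, hs⟩ := hg (g t)⁻¹
  have key : ∀ x, g x = 1 → IsUnit x := by
    intro x hx
    have h1 : 1 - x ∈ RingHom.ker g := by rw [RingHom.mem_ker, map_sub, hx, map_one, sub_self]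
    have := (isNilpotent_of_mem_isNilpotent hK h1).isUnit_one_sub
    rwa [sub_sub_cancel] at this
  obtain ⟨w, hw⟩ := (key (t * s) (by rw [map_mul, hs, mul_inv_cancel₀ ht])).exists_right_inv
  obtain ⟨w', hw'⟩ := (key (s * t) (by rw [map_mul, hs, inv_mul_cancel₀ ht])).exists_left_inv
  exact isUnit_iff_exists_and_exists.2 ⟨⟨s * w, by rw [← mul_assoc, hw]⟩,
    ⟨w' * s, by rw [mul_assoc, hw']⟩⟩

/-- The matrices with entries in `J` form a left ideal. The rows of a generator of it generate the
left module `J ^ ι`, using only as many rows as `ι` has elements. -/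
theorem exists_row_generators {ι : Type*} [Fintype ι] [DecidableEq ι] [Nonempty ι]
    (hP : ∀ I : Ideal (Matrix ι ι T), I.IsPrincipal) (J : Ideal T) [J.IsTwoSided] :
    ∃ A : Matrix ι ι T, (∀ i j, A i j ∈ J) ∧
      ∀ v : ι → T, (∀ j, v j ∈ J) → ∃ y : ι → T, ∀ j, ∑ k, y k * A k j = v j := by
  let I : Ideal (Matrix ι ι T) :=
    { carrier := {X | ∀ i j, X i j ∈ J}
      add_mem' := fun {X Y} hX hY i j => add_mem (hX i j) (hY i j)
      zero_mem' := fun i j => zero_mem J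
      smul_mem' := fun C X hX i j => by
        rw [smul_eq_mul, Matrix.mul_apply]
        exact sum_mem fun k _ => Ideal.mul_mem_left _ _ (hX k j) }
  obtain ⟨A, hA⟩ := hP I
  refine ⟨A, ?_, fun v hv => ?_⟩
  · have : A ∈ I := hA ▸ Submodule.mem_span_singleton_self A
    exact this
  · have : Matrix.of (fun _ : ι => v) ∈ I := fun i j => hv j
    rw [hA, Submodule.mem_span_singleton] at this
    obtain ⟨Y, hY⟩ := this
    refine ⟨Y (Classical.arbitrary ι), fun j => ?_⟩
    have := congrFun (congrFun hY (Classical.arbitrary ι)) j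
    rw [smul_eq_mul, Matrix.mul_apply] at this
    exact this

/-- The row generators give a surjection from `(T/J) ^ ι` onto `(J/J²) ^ ι`; comparing lengths and
cancelling the number of coordinates leaves at most `1`. -/
theorem length_le_one_of_row_generators {ι : Type*} [Fintype ι] [DecidableEq ι] [Nonempty ι]
    (hP : ∀ I : Ideal (Matrix ι ι T), I.IsPrincipal) (J : Ideal T) [J.IsTwoSided]
    (hJ : IsSimpleModule T (T ⧸ J)) :
    Module.length T (J ⧸ (J • ⊤ : Submodule T J)) ≤ 1 := by
  obtain ⟨A, hAJ, hA⟩ := exists_row_generators hP J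
  let V := J ⧸ (J • ⊤ : Submodule T J)
  let row : ι → ι → V := fun k j => Submodule.Quotient.mk ⟨A k j, hAJ k j⟩
  have hrow : ∀ k, J ≤ LinearMap.ker (LinearMap.toSpanSingleton T (ι → V) (row k)) := by
    intro k x hx
    rw [LinearMap.mem_ker, LinearMap.toSpanSingleton_apply]
    ext j
    rw [Pi.smul_apply, Pi.zero_apply]
    exact (Submodule.Quotient.mk_eq_zero _).2
      (Submodule.smul_mem_smul hx (Submodule.mem_top (x := (⟨A k j, hAJ k j⟩ : J))))
  let φ : (ι → T ⧸ J) →ₗ[T] (ι → V) :=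
    ∑ k, (Submodule.liftQ J (LinearMap.toSpanSingleton T (ι → V) (row k)) (hrow k)).comp
      (LinearMap.proj k)
  have hφ : Function.Surjective φ := by
    intro w
    choose v hv using fun j => Submodule.Quotient.mk_surjective _ (w j)
    obtain ⟨y, hy⟩ := hA (fun j => (v j : T)) fun j => (v j).2
    refine ⟨fun k => Submodule.Quotient.mk (y k), ?_⟩
    ext j
    rw [← hv j]
    have h1 : v j = ∑ k, y k • (⟨A k j, hAJ k j⟩ : J) := by
      apply Subtype.ext
      rw [← hy j]
      simp
    rw [h1]
    simp only [φ, LinearMap.sum_apply, LinearMap.comp_apply, LinearMap.proj_apply,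
      Submodule.liftQ_apply, LinearMap.toSpanSingleton_apply, Finset.sum_apply, Pi.smul_apply, row]
    exact (map_sum (Submodule.mkQ (J • ⊤ : Submodule T J)) _ _).symm
  have h1 := Module.length_le_of_surjective φ hφ
  rw [Module.length_pi_of_fintype, Module.length_pi_of_fintype, Finset.sum_const,
    Finset.sum_const, Module.length_eq_one (R := T) (M := T ⧸ J)] at h1
  by_contra hlt
  have h2 : (2 : ℕ∞) ≤ Module.length T V := by
    have := Order.add_one_le_of_lt (not_le.1 hlt)
    rwa [one_add_one_eq_two] at this
  have h3 : Finset.univ.card (α := ι) • (2 : ℕ∞) ≤ Finset.univ.card (α := ι) • 1 :=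
    (nsmul_le_nsmul_right h2 _).trans h1
  have h4 : 0 < Finset.univ.card (α := ι) := Finset.card_pos.2 Finset.univ_nonempty
  rw [nsmul_eq_mul, nsmul_eq_mul] at h3
  have h5 : Finset.univ.card (α := ι) * 2 ≤ Finset.univ.card (α := ι) * 1 := by exact_mod_cast h3
  omega

/-- Nakayama for a nilpotent ideal: `J/J²` is cyclic, so `J ⊆ Tx + J²`, hence `J ⊆ Tx + J ^ m` for
all `m ≥ 1`. -/
theorem exists_generator_ker {ι : Type*} [Fintype ι] [DecidableEq ι] [Nonempty ι]
    (hP : ∀ I : Ideal (Matrix ι ι T), I.IsPrincipal) {D : Type*} [DivisionRing D] (g : T →+* D)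
    (hg : Function.Surjective g) (hK : IsNilpotent (RingHom.ker g)) :
    ∃ p ∈ RingHom.ker g, ∀ x ∈ RingHom.ker g, ∃ y, x = y * p := by
  set J := RingHom.ker g with hJ
  have hsimple : IsSimpleModule T (T ⧸ J) := by
    rw [isSimpleModule_iff_isCoatom]
    refine ⟨?_, fun I hI => ?_⟩
    · rw [Ideal.ne_top_iff_one, hJ, RingHom.mem_ker, map_one]
      exact one_ne_zero
    · obtain ⟨x, hx, hxJ⟩ := Set.exists_of_ssubset hI
      exact Ideal.eq_top_of_isUnit_mem _ hx (isUnit_of_notMem_ker g hg hK hxJ)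
  have hlen := length_le_one_of_row_generators hP J hsimple
  obtain ⟨x, hx⟩ : ∃ x : J, ∀ v : J ⧸ (J • ⊤ : Submodule T J),
      ∃ t : T, t • Submodule.Quotient.mk x = v := by
    rcases hlen.lt_or_eq with h | h
    · have : Subsingleton (J ⧸ (J • ⊤ : Submodule T J)) :=
        (Module.length_eq_zero_iff (R := T)).1 (Order.lt_one_iff.1 h)
      exact ⟨0, fun v => ⟨0, Subsingleton.elim _ _⟩⟩
    · have := Module.length_eq_one_iff.1 h
      have := IsSimpleModule.nontrivial T (J ⧸ (J • ⊤ : Submodule T J))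
      obtain ⟨v, hv⟩ := exists_ne (0 : J ⧸ (J • ⊤ : Submodule T J))
      obtain ⟨x, rfl⟩ := Submodule.Quotient.mk_surjective _ v
      exact ⟨x, IsSimpleModule.toSpanSingleton_surjective T hv⟩
  refine ⟨x, x.2, ?_⟩
  have hstep : J ≤ Ideal.span {(x : T)} ⊔ J * J := by
    intro z hz
    obtain ⟨t, ht⟩ := hx (Submodule.Quotient.mk ⟨z, hz⟩)
    have h1 : (⟨z, hz⟩ : J) - t • x ∈ (J • ⊤ : Submodule T J) :=
      (Submodule.Quotient.eq _).1 (ht.symm.trans (Submodule.Quotient.mk_smul _ _ _).symm)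
    have h2 : z - t * x ∈ J * J := by
      have := Submodule.mem_map_of_mem (f := J.subtype) h1
      rw [Submodule.map_smul'', Submodule.map_subtype_top] at this
      exact this
    rw [show z = t * x + (z - t * x) by abel]
    exact Submodule.add_mem_sup (Ideal.mul_mem_left _ _ (Ideal.mem_span_singleton_self _)) h2
  have hpow : ∀ m, J ≤ Ideal.span {(x : T)} ⊔ J ^ (m + 1) := by
    intro m
    induction m with
    | zero => rw [zero_add, Submodule.pow_one]; exact le_sup_right
    | succ m ih =>
      refine ih.trans (sup_le le_sup_left ?_)
      rw [Submodule.pow_succ]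
      rw [Ideal.mul_le]
      intro r hr s hs
      obtain ⟨a, ha, b, hb, rfl⟩ := Submodule.mem_sup.1 (hstep hs)
      obtain ⟨c, rfl⟩ := Ideal.mem_span_singleton'.1 ha
      rw [mul_add]
      refine Submodule.add_mem_sup ?_ ?_
      · rw [← mul_assoc]
        exact Ideal.mul_mem_left _ _ (Ideal.mem_span_singleton_self _)
      · rw [Submodule.pow_succ, Submodule.pow_succ, mul_assoc]
        exact Ideal.mul_mem_mul hr hb
  obtain ⟨n, hn⟩ := hK
  intro z hz
  have h1 := hpow n hz
  rw [Submodule.pow_succ, hn, zero_mul, Submodule.zero_eq_bot, sup_bot_eq] at h1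
  obtain ⟨y, hy⟩ := Ideal.mem_span_singleton'.1 h1
  exact ⟨y, hy.symm⟩

end Local

/-! ### Structure of artinian principal rings -/

section Structure

/-- `T` is a local ring whose maximal ideal `T p = p T` satisfies `p ^ n = 0`. -/
structure IsChainRing (T : Type u) [Ring T] (p : T) (n : ℕ) : Prop where
  nontrivial : Nontrivial T
  pow_eq_zero : p ^ n = 0
  left : ∀ x, IsUnit x ∨ ∃ y, x = y * p
  right : ∀ x, IsUnit x ∨ ∃ y, x = p * y

variable {A : Type u} [Ring A]

theorem forall_isPrincipal_matrix_op {ι T : Type*} [Fintype ι] [DecidableEq ι] [Ring T]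
    (h : ∀ I : Ideal (Matrix ι ι T)ᵐᵒᵖ, I.IsPrincipal) (I : Ideal (Matrix ι ι Tᵐᵒᵖ)) :
    I.IsPrincipal :=
  let f : (Matrix ι ι T)ᵐᵒᵖ ≃+* Matrix ι ι Tᵐᵒᵖ := RingEquiv.mopMatrix.symm
  forall_isPrincipal_of_surjective (f : (Matrix ι ι T)ᵐᵒᵖ →+* Matrix ι ι Tᵐᵒᵖ)
    f.surjective h I

theorem forall_isPrincipal_op_of_surjective {B : Type*} [Ring B] (f : A →+* B)
    (hf : Function.Surjective f) (h : ∀ I : Ideal Aᵐᵒᵖ, I.IsPrincipal) (I : Ideal Bᵐᵒᵖ) :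
    I.IsPrincipal :=
  forall_isPrincipal_of_surjective f.op (fun y => by
    obtain ⟨x, hx⟩ := hf (unop y)
    exact ⟨op x, congrArg op hx⟩) h I

theorem exists_isChainRing {ι : Type*} [Fintype ι] [DecidableEq ι] [Nonempty ι] {T : Type u}
    [Ring T] (hP : ∀ I : Ideal (Matrix ι ι T), I.IsPrincipal)
    (hP' : ∀ I : Ideal (Matrix ι ι T)ᵐᵒᵖ, I.IsPrincipal) {D : Type*} [DivisionRing D]
    (g : T →+* D) (hg : Function.Surjective g) (hK : IsNilpotent (RingHom.ker g)) :
    ∃ p n, IsChainRing T p n := by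
  obtain ⟨p, hp, hleft⟩ := exists_generator_ker hP g hg hK
  obtain ⟨q, hq, hright⟩ := exists_generator_ker (forall_isPrincipal_matrix_op hP') g.op
    (fun y => by
      obtain ⟨x, hx⟩ := hg (unop y)
      exact ⟨op x, congrArg op hx⟩) (isNilpotent_ker_op g hK)
  have hright' : ∀ x ∈ RingHom.ker g, ∃ y, x = unop q * y := fun x hx => by
    obtain ⟨y, hy⟩ := hright (op x) ((op_eq_zero_iff _).2 hx)
    exact ⟨unop y, congrArg unop hy⟩
  have hunit : ∀ x, IsUnit x ∨ x ∈ RingHom.ker g := fun x => by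
    by_cases h : g x = 0
    · exact Or.inr h
    · exact Or.inl (isUnit_of_notMem_ker g hg hK h)
  obtain ⟨n, hn⟩ := isNilpotent_of_mem_isNilpotent hK hp
  refine ⟨p, n, g.domain_nontrivial, hn, fun x => (hunit x).imp_right (hleft x),
    fun x => (hunit x).imp_right fun hx => ?_⟩
  -- The left generator `p` also generates on the right: in `p = qs`, either `s` is a unit, or `s =
  -- tp` and `(1 - qt)p = 0` forces `p = 0`.
  obtain ⟨s, hs⟩ := hright' p hp
  rcases hunit s with h | h
  · obtain ⟨y, hy⟩ := hright' x hx
    obtain ⟨w, hw⟩ := h.exists_right_inv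
    refine ⟨w * y, ?_⟩
    rw [hs, mul_assoc, ← mul_assoc s, hw, one_mul, hy]
  · obtain ⟨t, ht⟩ := hleft s h
    have hqt : unop q * t ∈ RingHom.ker g := Ideal.mul_mem_right _ _ ((op_eq_zero_iff _).1 hq)
    obtain ⟨w, hw⟩ :=
      (isNilpotent_of_mem_isNilpotent hK hqt).isUnit_one_sub.exists_left_inv
    have hp0 : p = 0 := by
      calc p = w * (1 - unop q * t) * p := by rw [hw, one_mul]
        _ = w * (p - unop q * (t * p)) := by noncomm_ring
        _ = 0 := by rw [← ht, ← hs, sub_self, mul_zero]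
    obtain ⟨y, hy⟩ := hleft x hx
    exact ⟨0, by rw [hy, hp0, mul_zero, zero_mul]⟩

/-- An artinian principal ring is a finite product of matrix rings over artinian principal local
rings. -/
theorem exists_ringEquiv_pi_matrix_isChainRing [IsArtinianRing A]
    (hP : ∀ I : Ideal A, I.IsPrincipal) (hP' : ∀ I : Ideal Aᵐᵒᵖ, I.IsPrincipal) :
    ∃ (n : ℕ) (k : Fin n → ℕ) (L : Fin n → Type u) (_ : ∀ i, Ring (L i))
      (p : ∀ i, L i) (m : Fin n → ℕ),
      Nonempty (A ≃+* (∀ i, Matrix (Fin (k i)) (Fin (k i)) (L i))) ∧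
      (∀ i, 0 < k i) ∧ ∀ i, IsChainRing (L i) (p i) (m i) := by
  obtain ⟨n, D, k, _, hk, ⟨ψ⟩⟩ :=
    IsSemisimpleRing.exists_ringEquiv_pi_matrix_divisionRing (A ⧸ Ring.jacobson A)
  set J := Ring.jacobson A with hJ
  have hJnil : IsNilpotent J := IsSemiprimaryRing.isNilpotent
  let F : A →+* (∀ i, Matrix (Fin (k i)) (Fin (k i)) (D i)) :=
    (ψ : A ⧸ J →+* _).comp (Ideal.Quotient.mk J)
  have hFsurj : Function.Surjective F := ψ.surjective.comp Ideal.Quotient.mk_surjective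
  have hFker : ∀ x, F x = 0 → x ∈ J := fun x hx =>
    Ideal.Quotient.eq_zero_iff_mem.1 ((map_eq_zero_iff ψ ψ.injective).1 hx)
  obtain ⟨e, he, hFe⟩ := CompleteOrthogonalIdempotents.lift_of_isNilpotent_ker F
    (fun x hx => isNilpotent_of_mem_isNilpotent hJnil (hFker x hx))
    (CompleteOrthogonalIdempotents.single fun i => Matrix (Fin (k i)) (Fin (k i)) (D i))
    fun i => hFsurj _
  have hFe : ∀ i, F (e i) = Pi.single i 1 := fun i => congrFun hFe i
  -- Lifts of central idempotents are usually not central; here `commute_of_idempotent` makes them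
  -- so.
  have hcomm : ∀ i x, e i * x = x * e i := fun i =>
    commute_of_idempotent hP hJnil (he.idem i) fun x => hFker _ <| by
      rw [map_sub, map_mul, map_mul, hFe, sub_eq_zero]
      ext j : 1
      rcases eq_or_ne j i with rfl | h
      · simp
      · simp [h]
  let Φ := he.ringEquivOfIsMulCentral fun i =>
    IsMulCentral.mk (hcomm i) (fun b c => (mul_assoc _ b c).symm) (fun a b => mul_assoc a b _)
  have key : ∀ i, ∃ (T : Type u) (_ : Ring T) (p : T) (m : ℕ),
      Nonempty ((he.idem i).Corner ≃+* Matrix (Fin (k i)) (Fin (k i)) T) ∧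
        IsChainRing T p m := by
    intro i
    have hkpos : NeZero (k i) := hk i
    set val := cornerVal (he.idem i) with hval
    have hcor : ∀ t j, j ≠ i → F (val t) j = 0 := by
      intro t j hj
      rw [← mul_cornerVal (he.idem i) t, map_mul, hFe, Pi.mul_apply, Pi.single_eq_of_ne hj,
        zero_mul]
    let G : (he.idem i).Corner →+* Matrix (Fin (k i)) (Fin (k i)) (D i) :=
      { toFun := fun t => F (val t) i
        map_one' := by rw [hval, cornerVal_one, hFe, Pi.single_eq_same]
        map_zero' := by rw [map_zero, map_zero, Pi.zero_apply]
        map_add' := fun s t => by rw [map_add, map_add, Pi.add_apply]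
        map_mul' := fun s t => by rw [hval, cornerVal_mul, map_mul, Pi.mul_apply] }
    have hG : ∀ t, G t = F (val t) i := fun _ => rfl
    have hGsurj : Function.Surjective G := fun y => by
      obtain ⟨x, hx⟩ := hFsurj (Pi.single i y)
      have hei : e i * e i = e i := he.idem i
      refine ⟨cornerMk (he.idem i) (e i * x * e i) (by simp only [← mul_assoc, hei])
        (by rw [mul_assoc, hei]), ?_⟩
      rw [hG, hval, cornerVal_cornerMk, map_mul, map_mul, hx, hFe]
      simp
    have hGker : IsNilpotent (RingHom.ker G) := by
      refine isNilpotent_ker_corner (he.idem i) G hJnil fun t ht => hFker _ ?_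
      ext j : 1
      rcases eq_or_ne j i with rfl | h
      · exact ht
      · exact hcor t j h
    obtain ⟨T, _, g, ⟨φ⟩, hg, hgker⟩ := exists_ringEquiv_matrix_of_surjective G hGsurj hGker
    let Ψ : A →+* Matrix (Fin (k i)) (Fin (k i)) T :=
      (φ : _ →+* Matrix (Fin (k i)) (Fin (k i)) T).comp
        ((Pi.evalRingHom (fun j => (he.idem j).Corner) i).comp (Φ : A →+* _))
    have hΨ : Function.Surjective Ψ :=
      φ.surjective.comp ((Function.surjective_eval i).comp Φ.surjective)
    obtain ⟨p, m, hT⟩ := exists_isChainRing (forall_isPrincipal_of_surjective Ψ hΨ hP)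
      (forall_isPrincipal_op_of_surjective Ψ hΨ hP') g hg hgker
    exact ⟨T, inferInstance, p, m, ⟨φ⟩, hT⟩
  choose T hring p m φ hT using key
  exact ⟨n, k, T, hring, p, m, ⟨Φ.trans (RingEquiv.piCongrRight fun i => (φ i).some)⟩,
    fun i => Nat.pos_of_ne_zero (hk i).out, hT⟩

end Structure

/-! ### Arithmetic of chain rings -/

theorem isNilpotent_mul_of_normal {S : Type*} [Ring S] {p : S} (hp : ∀ x, ∃ y, p * x = y * p)
    {n : ℕ} (hn : p ^ n = 0) (y : S) : IsNilpotent (y * p) := by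
  have hpow : ∀ i x, ∃ y, p ^ i * x = y * p ^ i := by
    intro i
    induction i with
    | zero => exact fun x => ⟨x, by simp⟩
    | succ i ih =>
      intro x
      obtain ⟨y, hy⟩ := hp x
      obtain ⟨z, hz⟩ := ih y
      exact ⟨z, by rw [pow_succ, mul_assoc, hy, ← mul_assoc, hz, mul_assoc]⟩
  have key : ∀ m, ∃ z, (y * p) ^ m = z * p ^ m := by
    intro m
    induction m with
    | zero => exact ⟨1, by simp⟩
    | succ m ih =>
      obtain ⟨z, hz⟩ := ih
      obtain ⟨w, hw⟩ := hpow m y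
      exact ⟨z * w, by
        rw [pow_succ, hz, pow_succ, mul_assoc, ← mul_assoc (p ^ m), hw]; noncomm_ring⟩
  obtain ⟨z, hz⟩ := key n
  exact ⟨n, by rw [hz, hn, mul_zero]⟩

namespace IsChainRing

variable {T : Type u} [Ring T] {p : T} {n : ℕ}

theorem op (h : IsChainRing T p n) : IsChainRing Tᵐᵒᵖ (op p) n where
  nontrivial := have := h.nontrivial; inferInstance
  pow_eq_zero := by rw [← op_pow, h.pow_eq_zero, op_zero]
  left x := (h.right (unop x)).imp (fun hx => by simpa using hx.op)
    fun ⟨y, hy⟩ => ⟨MulOpposite.op y, congrArg MulOpposite.op hy⟩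
  right x := (h.left (unop x)).imp (fun hx => by simpa using hx.op)
    fun ⟨y, hy⟩ => ⟨MulOpposite.op y, congrArg MulOpposite.op hy⟩

theorem mul_ne_one (h : IsChainRing T p n) (x : T) : p * x ≠ 1 := by
  intro hx
  have := h.nontrivial
  have key : ∀ m, p ^ m * x ^ m = 1 := by
    intro m
    induction m with
    | zero => simp
    | succ m ih =>
      rw [pow_succ, pow_succ', mul_assoc, ← mul_assoc p x, hx, one_mul, ih]
  have := key n
  rw [h.pow_eq_zero, zero_mul] at this
  exact zero_ne_one this

theorem exists_mul_eq_mul (h : IsChainRing T p n) (x : T) : ∃ y, p * x = y * p :=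
  (h.left (p * x)).resolve_left fun hu => by
    obtain ⟨w, hw⟩ := hu.exists_right_inv
    exact h.mul_ne_one (x * w) (by rw [← mul_assoc, hw])

theorem exists_pow_mul_eq_mul_pow (h : IsChainRing T p n) (i : ℕ) (x : T) :
    ∃ y, p ^ i * x = y * p ^ i := by
  induction i generalizing x with
  | zero => exact ⟨x, by simp⟩
  | succ i ih =>
    obtain ⟨y, hy⟩ := h.exists_mul_eq_mul x
    obtain ⟨z, hz⟩ := ih y
    exact ⟨z, by rw [pow_succ, mul_assoc, hy, ← mul_assoc, hz, mul_assoc]⟩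

theorem exists_mul_pow_eq_pow_mul (h : IsChainRing T p n) (i : ℕ) (x : T) :
    ∃ y, x * p ^ i = p ^ i * y := by
  obtain ⟨y, hy⟩ := h.op.exists_pow_mul_eq_mul_pow i (MulOpposite.op x)
  refine ⟨unop y, ?_⟩
  simpa using congrArg unop hy

/-- Factors `p` are split off until the cofactor is a unit or the exponent reaches `n`, where `x =
0` is written as `1 * p ^ n`. -/
theorem exists_eq_unit_mul_pow (h : IsChainRing T p n) (x : T) :
    ∃ (u : Tˣ) (i : ℕ), i ≤ n ∧ x = u * p ^ i := by
  have key : ∀ m ≤ n, (∃ (u : Tˣ) (i : ℕ), i ≤ n ∧ x = u * p ^ i) ∨ ∃ y, x = y * p ^ m := by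
    intro m
    induction m with
    | zero => exact fun _ => Or.inr ⟨x, by simp⟩
    | succ m ih =>
      intro hm
      rcases ih (by omega) with h1 | ⟨y, hy⟩
      · exact Or.inl h1
      · rcases h.left y with ⟨u, rfl⟩ | ⟨z, rfl⟩
        · exact Or.inl ⟨u, m, by omega, hy⟩
        · exact Or.inr ⟨z, by rw [hy, pow_succ', mul_assoc]⟩
  rcases key n le_rfl with h1 | ⟨y, hy⟩
  · exact h1
  · exact ⟨1, n, le_rfl, by rw [hy, h.pow_eq_zero, mul_zero, mul_zero]⟩

theorem isNilpotent_mul (h : IsChainRing T p n) (y : T) : IsNilpotent (y * p) :=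
  isNilpotent_mul_of_normal h.exists_mul_eq_mul h.pow_eq_zero y

theorem isLocalRing (h : IsChainRing T p n) : IsLocalRing T :=
  have := h.nontrivial
  .of_is_unit_or_is_unit_of_add_one fun {a b} hab => by
    rcases h.left a with ha | ⟨y, rfl⟩
    · exact Or.inl ha
    · right
      rw [eq_sub_of_add_eq' hab]
      exact (h.isNilpotent_mul y).isUnit_one_sub

theorem exists_eq_span (h : IsChainRing T p n) (I : Ideal T) :
    ∃ i ≤ n, I = Ideal.span {p ^ i} := by
  classical
  have hex : ∃ i, p ^ i ∈ I := ⟨n, by rw [h.pow_eq_zero]; exact zero_mem I⟩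
  refine ⟨Nat.find hex, Nat.find_min' hex (by rw [h.pow_eq_zero]; exact zero_mem I),
    le_antisymm (fun x hx => ?_) ?_⟩
  · obtain ⟨u, i, -, rfl⟩ := h.exists_eq_unit_mul_pow x
    have hi : p ^ i ∈ I := by
      have := I.mul_mem_left (↑u⁻¹ : T) hx
      rwa [Units.inv_mul_cancel_left] at this
    obtain ⟨j, hj⟩ := Nat.exists_eq_add_of_le' (Nat.find_min' hex hi)
    rw [hj, pow_add, ← mul_assoc]
    exact Ideal.mul_mem_left _ _ (Ideal.mem_span_singleton_self _)
  · rw [Ideal.span_le, Set.singleton_subset_iff]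
    exact Nat.find_spec hex

theorem isArtinianRing (h : IsChainRing T p n) : IsArtinianRing T := by
  have : Function.Surjective fun i : Fin (n + 1) => Ideal.span {p ^ (i : ℕ)} := fun I => by
    obtain ⟨i, hi, rfl⟩ := h.exists_eq_span I
    exact ⟨⟨i, by omega⟩, rfl⟩
  have : Finite (Submodule T T) := Finite.of_surjective _ this
  exact Finite.to_wellFoundedLT

theorem isPrincipalRing (h : IsChainRing T p n) : IsPrincipalRing T :=
  isPrincipalRing_iff.2 ⟨fun I => let ⟨i, _, hi⟩ := h.exists_eq_span I; ⟨p ^ i, hi⟩,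
    fun I => let ⟨_, _, hi⟩ := h.op.exists_eq_span I; ⟨_, hi⟩⟩

theorem isTwoSidedArtinianRing (h : IsChainRing T p n) : IsTwoSidedArtinianRing T :=
  isTwoSidedArtinianRing_iff.2 ⟨h.isArtinianRing, h.op.isArtinianRing⟩

/-- Among finitely many elements there is one that divides all of them on both sides. -/
theorem exists_forall_dvd (h : IsChainRing T p n) {α : Type*} [Finite α] [Nonempty α]
    (d : α → T) : ∃ a, ∀ b, (∃ c, d b = c * d a) ∧ ∃ c, d b = d a * c := by
  choose w i _ hd using fun a => h.exists_eq_unit_mul_pow (d a)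
  obtain ⟨a, ha⟩ := Finite.exists_min i
  refine ⟨a, fun b => ?_⟩
  obtain ⟨j, hj⟩ := Nat.exists_eq_add_of_le' (ha b)
  constructor
  · refine ⟨w b * p ^ j * ↑(w a)⁻¹, ?_⟩
    rw [hd b, hd a, hj, pow_add, mul_assoc (_ * _) _ (_ * _), Units.inv_mul_cancel_left, mul_assoc]
  · obtain ⟨c, hc⟩ := h.exists_mul_pow_eq_pow_mul (i a) (↑(w a)⁻¹ * (w b * p ^ j))
    refine ⟨c, ?_⟩
    rw [hd b, hd a, hj, mul_assoc, ← hc, ← mul_assoc, ← mul_assoc, Units.mul_inv, one_mul,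
      pow_add, mul_assoc]

theorem mul_pow_eq_zero_iff (h : IsChainRing T p n) (hn : ∀ m < n, p ^ m ≠ 0) {i : ℕ}
    (hi : i ≤ n) (x : T) : x * p ^ i = 0 ↔ ∃ y, y * p ^ (n - i) = x := by
  constructor
  · intro hx
    obtain ⟨w, m, -, rfl⟩ := h.exists_eq_unit_mul_pow x
    rw [mul_assoc, Units.mul_right_eq_zero, ← pow_add] at hx
    have hm : n ≤ m + i := by
      by_contra hlt
      exact hn _ (by omega) hx
    refine ⟨w * p ^ (m - (n - i)), ?_⟩
    rw [mul_assoc, ← pow_add]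
    congr 2
    omega
  · rintro ⟨y, rfl⟩
    rw [mul_assoc, ← pow_add, Nat.sub_add_cancel hi, h.pow_eq_zero, mul_zero]

end IsChainRing

/-! ### Pairs of mutually annihilating generators -/

section MorphicPairs

/-- The elements `a` and `b` generate each other's left and right annihilators. -/
structure MorphicPair {S : Type u} [Ring S] (a b : S) : Prop where
  left : ∀ x, x * a = 0 ↔ ∃ y, y * b = x
  left' : ∀ x, x * b = 0 ↔ ∃ y, y * a = x
  right : ∀ x, a * x = 0 ↔ ∃ y, b * y = x
  right' : ∀ x, b * x = 0 ↔ ∃ y, a * y = x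

theorem MorphicPair.symm {S : Type u} [Ring S] {a b : S} (h : MorphicPair a b) :
    MorphicPair b a :=
  ⟨h.left', h.left, h.right', h.right⟩

variable {T : Type u} [Ring T] {p : T} {n : ℕ}

theorem units_mul_left_exists {S : Type u} [Ring S] (w : Sˣ) (b x : S) :
    (∃ y, y * (w * b) = x) ↔ ∃ y, y * b = x :=
  ⟨fun ⟨y, hy⟩ => ⟨y * w, by rw [mul_assoc, hy]⟩,
    fun ⟨y, hy⟩ => ⟨y * ↑w⁻¹, by rw [mul_assoc, Units.inv_mul_cancel_left, hy]⟩⟩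

theorem units_mul_right_exists {S : Type u} [Ring S] (w : Sˣ) (b x : S) :
    (∃ y, b * w * y = x) ↔ ∃ y, b * y = x :=
  ⟨fun ⟨y, hy⟩ => ⟨w * y, by rw [← mul_assoc, hy]⟩,
    fun ⟨y, hy⟩ => ⟨↑w⁻¹ * y, by rw [← mul_assoc, Units.mul_inv_cancel_right, hy]⟩⟩

theorem MorphicPair.units_mul {S : Type u} [Ring S] {a b : S} (h : MorphicPair a b) (w : Sˣ) :
    MorphicPair (w * a) (b * ↑w⁻¹) where
  left x := by
    rw [← mul_assoc, h.left]
    exact ⟨fun ⟨y, hy⟩ => ⟨y, by rw [← mul_assoc, hy, Units.mul_inv_cancel_right]⟩,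
      fun ⟨y, hy⟩ => ⟨y, by rw [← hy, ← mul_assoc, Units.inv_mul_cancel_right]⟩⟩
  left' x := by rw [← mul_assoc, Units.mul_left_eq_zero, h.left', units_mul_left_exists]
  right x := by rw [mul_assoc, Units.mul_right_eq_zero, h.right, units_mul_right_exists]
  right' x := by
    rw [mul_assoc, h.right']
    exact ⟨fun ⟨y, hy⟩ => ⟨y, by rw [mul_assoc, hy, Units.mul_inv_cancel_left]⟩,
      fun ⟨y, hy⟩ => ⟨y, by rw [← hy, mul_assoc, Units.inv_mul_cancel_left]⟩⟩

theorem MorphicPair.mul_units {S : Type u} [Ring S] {a b : S} (h : MorphicPair a b) (w : Sˣ) :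
    MorphicPair (a * w) (↑w⁻¹ * b) := by
  simpa using (h.symm.units_mul w⁻¹).symm

theorem IsChainRing.exists_morphicPair (h : IsChainRing T p n) (a : T) :
    ∃ b, MorphicPair a b := by
  classical
  -- `n` is replaced by the exact nilpotency index of `p`; only then are `p ^ i` and `p ^ (n - i)`
  -- mutual annihilators.
  have hex : ∃ m, p ^ m = 0 := ⟨n, h.pow_eq_zero⟩
  have h' : IsChainRing T p (Nat.find hex) :=
    ⟨h.nontrivial, Nat.find_spec hex, h.left, h.right⟩
  have hmin : ∀ m < Nat.find hex, p ^ m ≠ 0 := fun m hm => Nat.find_min hex hm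
  generalize Nat.find hex = n at h' hmin
  obtain ⟨w, i, hi, rfl⟩ := h'.exists_eq_unit_mul_pow a
  have hr : ∀ i ≤ n, ∀ x, p ^ i * x = 0 ↔ ∃ y, p ^ (n - i) * y = x := by
    intro i hi x
    have h1 := h'.op.mul_pow_eq_zero_iff (fun m hm h0 => hmin m hm (op_injective h0)) hi
      (MulOpposite.op x)
    simpa only [← op_pow, ← op_mul, op_eq_zero_iff, MulOpposite.exists, op_inj] using h1
  have hpair : MorphicPair (p ^ i) (p ^ (n - i)) := by
    have hni : n - (n - i) = i := Nat.sub_sub_self hi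
    refine ⟨h'.mul_pow_eq_zero_iff hmin hi, ?_, hr i hi, ?_⟩
    · have := h'.mul_pow_eq_zero_iff hmin (Nat.sub_le n i)
      rwa [hni] at this
    · have := hr (n - i) (Nat.sub_le n i)
      rwa [hni] at this
  exact ⟨_, hpair.units_mul w⟩

theorem MorphicPair.diagonal {ι : Type*} [Fintype ι] [DecidableEq ι] {d d' : ι → T}
    (h : ∀ i, MorphicPair (d i) (d' i)) :
    MorphicPair (Matrix.diagonal d) (Matrix.diagonal d') := by
  have hl : ∀ d d' : ι → T, (∀ i x, x * d i = 0 ↔ ∃ y, y * d' i = x) → ∀ X : Matrix ι ι T,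
      X * Matrix.diagonal d = 0 ↔ ∃ Y, Y * Matrix.diagonal d' = X := by
    intro d d' h X
    simp only [← Matrix.ext_iff, Matrix.mul_diagonal, Matrix.zero_apply, h]
    exact ⟨fun hX => by choose Y hY using hX; exact ⟨Y, hY⟩, fun ⟨Y, hY⟩ i j => ⟨Y i j, hY i j⟩⟩
  have hr : ∀ d d' : ι → T, (∀ i x, d i * x = 0 ↔ ∃ y, d' i * y = x) → ∀ X : Matrix ι ι T,
      Matrix.diagonal d * X = 0 ↔ ∃ Y, Matrix.diagonal d' * Y = X := by
    intro d d' h X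
    simp only [← Matrix.ext_iff, Matrix.diagonal_mul, Matrix.zero_apply, h]
    exact ⟨fun hX => by choose Y hY using hX; exact ⟨Y, hY⟩, fun ⟨Y, hY⟩ i j => ⟨Y i j, hY i j⟩⟩
  exact ⟨hl _ _ fun i => (h i).left, hl _ _ fun i => (h i).left', hr _ _ fun i => (h i).right,
    hr _ _ fun i => (h i).right'⟩

end MorphicPairs

/-! ### Diagonalization of matrices over a chain ring -/

section Diagonalization

variable {T : Type u} [Ring T] {p : T} {n : ℕ}

/-- The permutation matrix of `σ`, as a unit. -/
def permUnit {ι : Type*} [Fintype ι] [DecidableEq ι] (T : Type*) [Ring T] (σ : Equiv.Perm ι) :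
    (Matrix ι ι T)ˣ where
  val := σ.toPEquiv.toMatrix
  inv := σ.symm.toPEquiv.toMatrix
  val_inv := by
    rw [PEquiv.toMatrix_toPEquiv_mul]
    ext i j
    simp [PEquiv.toMatrix_apply, Matrix.one_apply]
  inv_val := by
    rw [PEquiv.toMatrix_toPEquiv_mul]
    ext i j
    simp [PEquiv.toMatrix_apply, Matrix.one_apply]

theorem submatrix_eq_permUnit {ι : Type*} [Fintype ι] [DecidableEq ι] (σ τ : Equiv.Perm ι)
    (A : Matrix ι ι T) :
    A.submatrix σ τ = permUnit T σ * A * permUnit T τ.symm := by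
  change _ = σ.toPEquiv.toMatrix * A * τ.symm.toPEquiv.toMatrix
  rw [PEquiv.toMatrix_toPEquiv_mul, PEquiv.mul_toMatrix_toPEquiv, Matrix.submatrix_submatrix]
  rfl

/-- `A` is equivalent to a diagonal matrix. -/
def IsDiagonalizable {ι : Type*} [Fintype ι] [DecidableEq ι] (A : Matrix ι ι T) : Prop :=
  ∃ (P Q : (Matrix ι ι T)ˣ) (d : ι → T), A = P * Matrix.diagonal d * Q

theorem IsDiagonalizable.of_units {ι : Type*} [Fintype ι] [DecidableEq ι] {A : Matrix ι ι T}
    (P Q : (Matrix ι ι T)ˣ) (h : IsDiagonalizable ((P : Matrix ι ι T) * A * (Q : Matrix ι ι T))) :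
    IsDiagonalizable A := by
  obtain ⟨P', Q', d, hd⟩ := h
  refine ⟨P⁻¹ * P', Q' * Q⁻¹, d, ?_⟩
  calc A = ↑P⁻¹ * (P * A * Q) * ↑Q⁻¹ := by
        rw [mul_assoc _ A, Units.inv_mul_cancel_left, Units.mul_inv_cancel_right]
    _ = _ := by rw [hd, Units.val_mul, Units.val_mul]; simp only [mul_assoc]

theorem isDiagonalizable_of_equiv {ι κ : Type*} [Fintype ι] [DecidableEq ι] [Fintype κ]
    [DecidableEq κ] (f : ι ≃ κ) (h : ∀ A : Matrix ι ι T, IsDiagonalizable A)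
    (A : Matrix κ κ T) : IsDiagonalizable A := by
  let φ : Matrix ι ι T ≃+* Matrix κ κ T := Matrix.reindexRingEquiv T f
  obtain ⟨P, Q, d, hd⟩ := h (φ.symm A)
  refine ⟨Units.map (φ : Matrix ι ι T →* Matrix κ κ T) P,
    Units.map (φ : Matrix ι ι T →* Matrix κ κ T) Q, d ∘ f.symm, ?_⟩
  have h1 : φ (Matrix.diagonal d) = Matrix.diagonal (d ∘ f.symm) :=
    Matrix.submatrix_diagonal_equiv d f.symm
  rw [← h1]
  have h2 := congrArg φ hd
  rw [RingEquiv.apply_symm_apply, map_mul, map_mul] at h2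
  exact h2

/-- The block unitriangular unit with upper right block `B`. -/
def upperUnit {ι κ : Type*} [Fintype ι] [DecidableEq ι] [Fintype κ] [DecidableEq κ]
    (B : Matrix ι κ T) : (Matrix (ι ⊕ κ) (ι ⊕ κ) T)ˣ where
  val := Matrix.fromBlocks 1 B 0 1
  inv := Matrix.fromBlocks 1 (-B) 0 1
  val_inv := by simp [Matrix.fromBlocks_multiply]
  inv_val := by simp [Matrix.fromBlocks_multiply]

/-- The block unitriangular unit with lower left block `B`. -/
def lowerUnit {ι κ : Type*} [Fintype ι] [DecidableEq ι] [Fintype κ] [DecidableEq κ]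
    (B : Matrix κ ι T) : (Matrix (ι ⊕ κ) (ι ⊕ κ) T)ˣ where
  val := Matrix.fromBlocks 1 0 B 1
  inv := Matrix.fromBlocks 1 0 (-B) 1
  val_inv := by simp [Matrix.fromBlocks_multiply]
  inv_val := by simp [Matrix.fromBlocks_multiply]

/-- A block diagonal unit. -/
def blockUnit {ι κ : Type*} [Fintype ι] [DecidableEq ι] [Fintype κ] [DecidableEq κ]
    (P : (Matrix ι ι T)ˣ) : (Matrix (ι ⊕ κ) (ι ⊕ κ) T)ˣ where
  val := Matrix.fromBlocks P 0 0 1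
  inv := Matrix.fromBlocks ↑P⁻¹ 0 0 1
  val_inv := by simp [Matrix.fromBlocks_multiply]
  inv_val := by simp [Matrix.fromBlocks_multiply]

/-- Smith reduction: an entry dividing all others on both sides is permuted into the last corner,
its row and column are cleared, and the remaining block is handled by induction. -/
theorem IsChainRing.isDiagonalizable_sum (h : IsChainRing T p n) {ι : Type*} [Fintype ι]
    [DecidableEq ι] (ih : ∀ A : Matrix ι ι T, IsDiagonalizable A)
    (A : Matrix (ι ⊕ Unit) (ι ⊕ Unit) T) : IsDiagonalizable A := by
  obtain ⟨⟨a, b⟩, hab⟩ := h.exists_forall_dvd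
    fun x : (ι ⊕ Unit) × (ι ⊕ Unit) => A x.1 x.2
  let σ := Equiv.swap (Sum.inr () : ι ⊕ Unit) a
  let τ := Equiv.swap (Sum.inr () : ι ⊕ Unit) b
  refine IsDiagonalizable.of_units (permUnit T σ) (permUnit T τ.symm) ?_
  rw [← submatrix_eq_permUnit]
  obtain ⟨B, hB⟩ : ∃ B, B = A.submatrix σ τ := ⟨_, rfl⟩
  have hdvd : ∀ x y, (∃ c, B x y = c * B (Sum.inr ()) (Sum.inr ())) ∧
      ∃ c, B x y = B (Sum.inr ()) (Sum.inr ()) * c := by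
    intro x y
    have h1 : B (Sum.inr ()) (Sum.inr ()) = A a b := by
      rw [hB, Matrix.submatrix_apply, Equiv.swap_apply_left, Equiv.swap_apply_left]
    rw [h1, hB]
    exact hab (σ x, τ y)
  rw [← hB]
  set d := B (Sum.inr ()) (Sum.inr ()) with hd
  choose c hc using fun i => (hdvd (Sum.inl i) (Sum.inr ())).1
  choose r hr using fun j => (hdvd (Sum.inr ()) (Sum.inl j)).2
  let C : Matrix ι Unit T := fun i _ => -c i
  let R : Matrix Unit ι T := fun _ j => -r j
  refine IsDiagonalizable.of_units (upperUnit C) (lowerUnit R) ?_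
  have hBblock : B = Matrix.fromBlocks B.toBlocks₁₁ B.toBlocks₁₂ B.toBlocks₂₁ B.toBlocks₂₂ :=
    (Matrix.fromBlocks_toBlocks B).symm
  have h22 : B.toBlocks₂₂ = Matrix.diagonal fun _ => d := by
    ext i j
    simp [Matrix.toBlocks₂₂, hd]
  have h12 : B.toBlocks₁₂ + C * B.toBlocks₂₂ = 0 := by
    ext i j
    rw [h22, Matrix.add_apply, Matrix.mul_diagonal, Matrix.zero_apply]
    change B (Sum.inl i) (Sum.inr ()) + -c i * d = 0
    rw [hc, neg_mul, add_neg_cancel]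
  have h21 : B.toBlocks₂₁ + B.toBlocks₂₂ * R = 0 := by
    ext i j
    rw [h22, Matrix.add_apply, Matrix.diagonal_mul, Matrix.zero_apply]
    change B (Sum.inr ()) (Sum.inl j) + d * -r j = 0
    rw [hr, mul_neg, add_neg_cancel]
  obtain ⟨P, Q, e, he⟩ := ih (B.toBlocks₁₁ + C * B.toBlocks₂₁)
  refine ⟨blockUnit P, blockUnit Q, Sum.elim e fun _ => d, ?_⟩
  rw [hBblock]
  rw [h22] at h12 h21
  simp only [upperUnit, lowerUnit, blockUnit, Matrix.fromBlocks_multiply, Matrix.one_mul,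
    Matrix.zero_mul, zero_add, add_zero, Matrix.mul_one, Matrix.mul_zero, h12, h21, he,
    ← Matrix.fromBlocks_diagonal, h22]

theorem IsChainRing.isDiagonalizable (h : IsChainRing T p n) (k : ℕ)
    (A : Matrix (Fin k) (Fin k) T) : IsDiagonalizable A := by
  induction k with
  | zero => exact ⟨1, 1, fun _ => 0, Subsingleton.elim _ _⟩
  | succ k ih =>
    exact isDiagonalizable_of_equiv (ι := Fin k ⊕ Unit)
      ((Equiv.sumCongr (Equiv.refl _) (Equiv.ofUnique Unit (Fin 1))).trans finSumFinEquiv)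
      (h.isDiagonalizable_sum ih) A

theorem IsChainRing.exists_morphicPair_matrix (h : IsChainRing T p n) (k : ℕ)
    (A : Matrix (Fin k) (Fin k) T) : ∃ B, MorphicPair A B := by
  obtain ⟨P, Q, d, rfl⟩ := h.isDiagonalizable k A
  choose d' hd using fun i => h.exists_morphicPair (d i)
  exact ⟨_, ((MorphicPair.diagonal hd).units_mul P).mul_units Q⟩

end Diagonalization

/-! ### Artinian principal rings are morphic -/

section Morphic

variable {S : Type u} [Ring S]

theorem MorphicPair.pi {ι : Type*} {B : ι → Type*} [∀ i, Ring (B i)] {a b : ∀ i, B i}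
    (h : ∀ i, MorphicPair (a i) (b i)) : MorphicPair a b where
  left x := by
    simp only [funext_iff, Pi.mul_apply, Pi.zero_apply, (h _).left]
    exact ⟨fun hx => ⟨_, fun i => (hx i).choose_spec⟩, fun ⟨y, hy⟩ i => ⟨y i, hy i⟩⟩
  left' x := by
    simp only [funext_iff, Pi.mul_apply, Pi.zero_apply, (h _).left']
    exact ⟨fun hx => ⟨_, fun i => (hx i).choose_spec⟩, fun ⟨y, hy⟩ i => ⟨y i, hy i⟩⟩
  right x := by
    simp only [funext_iff, Pi.mul_apply, Pi.zero_apply, (h _).right]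
    exact ⟨fun hx => ⟨_, fun i => (hx i).choose_spec⟩, fun ⟨y, hy⟩ i => ⟨y i, hy i⟩⟩
  right' x := by
    simp only [funext_iff, Pi.mul_apply, Pi.zero_apply, (h _).right']
    exact ⟨fun hx => ⟨_, fun i => (hx i).choose_spec⟩, fun ⟨y, hy⟩ i => ⟨y i, hy i⟩⟩

theorem MorphicPair.map {B : Type*} [Ring B] (f : S ≃+* B) {a b : S} (h : MorphicPair a b) :
    MorphicPair (f a) (f b) := by
  constructor <;> intro x <;> obtain ⟨x, rfl⟩ := f.surjective x
  · simp only [f.surjective.exists, ← map_mul, map_eq_zero_iff f f.injective, f.injective.eq_iff,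
      h.left]
  · simp only [f.surjective.exists, ← map_mul, map_eq_zero_iff f f.injective, f.injective.eq_iff,
      h.left']
  · simp only [f.surjective.exists, ← map_mul, map_eq_zero_iff f f.injective, f.injective.eq_iff,
      h.right]
  · simp only [f.surjective.exists, ← map_mul, map_eq_zero_iff f f.injective, f.injective.eq_iff,
      h.right']

/-- Right multiplication by `b` maps `S` onto `Sb = ann_l(a)` with kernel `ann_l(b) = Sa`; left
multiplication by `b` serves the other side. -/
theorem isMorphicRing_of_morphicPair (h : ∀ a : S, ∃ b, MorphicPair a b) :
    IsMorphicRing S := by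
  constructor
  · intro a
    obtain ⟨b, hb⟩ := h a
    let φ : S →ₗ[S] leftAnn a := (LinearMap.toSpanSingleton S S b).codRestrict (leftAnn a)
      fun c => (hb.left _).2 ⟨c, rfl⟩
    have hsurj : Function.Surjective φ := fun ⟨x, hx⟩ => by
      obtain ⟨y, hy⟩ := (hb.left x).1 hx
      exact ⟨y, Subtype.ext hy⟩
    have hker : leftPrincipal a = LinearMap.ker φ := by
      ext x
      rw [mem_leftPrincipal, ← hb.left', LinearMap.mem_ker]
      exact ⟨fun hx => Subtype.ext hx, fun hx => congrArg Subtype.val hx⟩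
    exact ⟨(Submodule.quotEquivOfEq _ _ hker).trans (φ.quotKerEquivOfSurjective hsurj)⟩
  · intro a
    obtain ⟨b, hb⟩ := h a
    let ψ : S →ₗ[Sᵐᵒᵖ] S :=
      { toFun := fun x => b * x
        map_add' := mul_add b
        map_smul' := fun c x => (mul_assoc b x (unop c)).symm }
    let φ : S →ₗ[Sᵐᵒᵖ] rightAnn a := ψ.codRestrict (rightAnn a)
      fun c => (hb.right _).2 ⟨c, rfl⟩
    have hsurj : Function.Surjective φ := fun ⟨x, hx⟩ => by
      obtain ⟨y, hy⟩ := (hb.right x).1 hx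
      exact ⟨y, Subtype.ext hy⟩
    have hker : rightPrincipal a = LinearMap.ker φ := by
      ext x
      rw [mem_rightPrincipal, ← hb.right', LinearMap.mem_ker]
      exact ⟨fun hx => Subtype.ext hx, fun hx => congrArg Subtype.val hx⟩
    exact ⟨(Submodule.quotEquivOfEq _ _ hker).trans (φ.quotKerEquivOfSurjective hsurj)⟩

/-- An artinian principal ring is morphic. -/
theorem isMorphicRing_of_isArtinianRing [IsArtinianRing S] (h : IsPrincipalRing S) :
    IsMorphicRing S := by
  obtain ⟨n, k, T, _, p, m, ⟨f⟩, -, hT⟩ := exists_ringEquiv_pi_matrix_isChainRing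
    (isPrincipalRing_iff.1 h).1 (isPrincipalRing_iff.1 h).2
  refine isMorphicRing_of_morphicPair fun a => ?_
  choose b hb using fun i => (hT i).exists_morphicPair_matrix (k i) (f a i)
  refine ⟨f.symm b, ?_⟩
  have := (MorphicPair.pi hb).map f.symm
  rwa [RingEquiv.symm_apply_apply] at this

end Morphic

/-! ### Bimodules over one block -/

section ChainBimodule

/-- Substituting `N = pN + Np` into its last term gives `N = pN + N p ^ s`. At `s = n` this is `N =
pN`, and iterating gives `N = p ^ n N = 0`. -/
theorem subsingleton_of_eq_smul_add_smul {R : Type u} {N : Type v} [Ring R] [AddCommGroup N]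
    [Module R N] [Module Rᵐᵒᵖ N] [SMulCommClass R Rᵐᵒᵖ N] {p : R} {n : ℕ} (hp : p ^ n = 0)
    (h : ∀ x : N, ∃ y z : N, x = p • y + op p • z) : Subsingleton N := by
  have key : ∀ s, ∀ x : N, ∃ y z : N, x = p • y + op (p ^ s) • z := by
    intro s
    induction s with
    | zero => exact fun x => ⟨0, x, by simp⟩
    | succ s ih =>
      intro x
      obtain ⟨y, z, hx⟩ := ih x
      obtain ⟨a, b, hz⟩ := h z
      refine ⟨y + op (p ^ s) • a, b, ?_⟩
      rw [hx, hz, smul_add, smul_add, add_assoc, smul_comm p (op (p ^ s)), ← mul_smul, ← op_mul,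
        ← pow_succ']
  have hleft : ∀ s, ∀ x : N, ∃ y : N, x = p ^ s • y := by
    intro s
    induction s with
    | zero => exact fun x => ⟨x, by simp⟩
    | succ s ih =>
      intro x
      obtain ⟨y, hy⟩ := ih x
      obtain ⟨a, b, hab⟩ := key n y
      refine ⟨a, ?_⟩
      rw [hp, op_zero, zero_smul, add_zero] at hab
      rw [hy, hab, ← mul_smul, ← pow_succ]
  refine subsingleton_of_forall_eq 0 fun x => ?_
  obtain ⟨y, hy⟩ := hleft n x
  rw [hy, hp, zero_smul]

variable {L : Type u} [Ring L] {p : L} {n k : ℕ} {N : Type v} [AddCommGroup N]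
  [Module (Matrix (Fin k) (Fin k) L) N] [Module (Matrix (Fin k) (Fin k) L)ᵐᵒᵖ N]
  [SMulCommClass (Matrix (Fin k) (Fin k) L) (Matrix (Fin k) (Fin k) L)ᵐᵒᵖ N]

/-- With `P` the scalar matrix `p`, let `(CP, a₂)` generate the left ideal of pairs whose first
entry is a left multiple of `P`. The matrix `C` is right invertible, so `(0, m) = x (CP, a₂)` forces
`x₁` to be a multiple of `P`, and `m = x₁ a₂ + x₂ CP` lies in `PN + NP`. -/
theorem IsChainRing.subsingleton_of_ne_zero (h : IsChainRing L p n) (hp : p ≠ 0)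
    (hl : ∀ I : Ideal (TrivSqZeroExt (Matrix (Fin k) (Fin k) L) N), I.IsPrincipal) :
    Subsingleton N := by
  have := h.isArtinianRing
  let P : Matrix (Fin k) (Fin k) L := Matrix.diagonal fun _ => p
  have hPn : P ^ n = 0 := by
    rw [Matrix.diagonal_pow]
    ext i j
    simp [Matrix.diagonal_apply, h.pow_eq_zero]
  have hPleft : ∀ X, ∃ Y, P * X = Y * P := by
    intro X
    choose Y hY using fun i j => h.exists_mul_eq_mul (X i j)
    exact ⟨Matrix.of Y, by ext i j; simp [P, hY]⟩
  have hPright : ∀ X, ∃ Y, X * P = P * Y := by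
    intro X
    choose Y hY using fun i j => h.exists_mul_pow_eq_pow_mul 1 (X i j)
    simp only [pow_one] at hY
    exact ⟨Matrix.of Y, by ext i j; simp [P, hY]⟩
  -- This is where `p ≠ 0` enters: an entry killing `p` is not a unit, hence is a multiple of `p`.
  have hann : ∀ X, X * P = 0 → ∃ Y, X = Y * P := by
    intro X hX
    have h1 : ∀ i j, ∃ y, X i j = y * p := fun i j => (h.left (X i j)).resolve_left fun hu => by
      have h2 := congrFun (congrFun hX i) j
      rw [Matrix.mul_diagonal, Matrix.zero_apply] at h2
      exact hp (hu.mul_right_eq_zero.1 h2)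
    choose Y hY using h1
    exact ⟨Matrix.of Y, by ext i j; simp [P, hY]⟩
  let I : Ideal (TrivSqZeroExt (Matrix (Fin k) (Fin k) L) N) :=
    { carrier := {z | ∃ Y, z.fst = Y * P}
      add_mem' := by
        rintro a b ⟨Y, hY⟩ ⟨Z, hZ⟩
        exact ⟨Y + Z, by rw [TrivSqZeroExt.fst_add, hY, hZ, add_mul]⟩
      zero_mem' := ⟨0, by rw [TrivSqZeroExt.fst_zero, zero_mul]⟩
      smul_mem' := by
        rintro c a ⟨Y, hY⟩
        exact ⟨c.fst * Y, by rw [smul_eq_mul, TrivSqZeroExt.fst_mul, hY, mul_assoc]⟩ }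
  obtain ⟨a, ha⟩ := hl I
  have haI : a ∈ I := ha ▸ Submodule.mem_span_singleton_self a
  obtain ⟨C, hC⟩ := haI
  have hgen : ∀ z ∈ I, ∃ x, x * a = z := fun z hz => by
    rw [ha, Submodule.mem_span_singleton] at hz
    exact hz
  obtain ⟨w, hw⟩ : ∃ w, C * w = 1 := by
    obtain ⟨x, hx⟩ := hgen (TrivSqZeroExt.inl P) ⟨1, (one_mul P).symm⟩
    have h1 := congrArg TrivSqZeroExt.fst hx
    rw [TrivSqZeroExt.fst_mul, TrivSqZeroExt.fst_inl, hC] at h1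
    obtain ⟨Y, hY⟩ := hann (1 - x.fst * C) (by rw [sub_mul, one_mul, mul_assoc, h1, sub_self])
    have h2 : IsUnit (x.fst * C) := by
      have := (isNilpotent_mul_of_normal hPleft hPn Y).isUnit_one_sub
      rwa [← hY, sub_sub_cancel] at this
    obtain ⟨v, hv⟩ := h2.exists_left_inv
    exact ⟨v * x.fst, mul_eq_one_symm (by rw [mul_assoc, hv])⟩
  refine subsingleton_of_eq_smul_add_smul hPn fun m => ?_
  obtain ⟨x, hx⟩ := hgen (TrivSqZeroExt.inr m) ⟨0, by rw [TrivSqZeroExt.fst_inr, zero_mul]⟩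
  have h1 := congrArg TrivSqZeroExt.fst hx
  have h2 := congrArg TrivSqZeroExt.snd hx
  rw [TrivSqZeroExt.fst_mul, TrivSqZeroExt.fst_inr, hC, ← mul_assoc] at h1
  rw [TrivSqZeroExt.snd_mul, TrivSqZeroExt.snd_inr, hC] at h2
  obtain ⟨Z, hZ⟩ := hann _ h1
  obtain ⟨W, hW⟩ := hPleft w
  obtain ⟨V, hV⟩ := hPright (Z * W)
  have hxfst : x.fst = P * V := by
    calc x.fst = x.fst * C * w := by rw [mul_assoc, hw, mul_one]
      _ = P * V := by rw [hZ, mul_assoc, hW, ← mul_assoc, hV]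
  refine ⟨V • a.snd, MulOpposite.op C • x.snd, ?_⟩
  rw [← h2, hxfst, mul_smul, op_mul, mul_smul]

/-- Principality of `0 × N` on both sides gives `N = Rm = m'R`. Once `m` is free on the left, `m r =
σ(r) m` determines `σ`, and `x ↦ x m` identifies `R(σ)` with `N`. -/
theorem exists_twist_of_isSimpleRing {R : Type u} {N : Type v} [Ring R] [AddCommGroup N]
    [Module R N] [Module Rᵐᵒᵖ N] [SMulCommClass R Rᵐᵒᵖ N] [IsSimpleRing R]
    [IsArtinianRing R] [IsArtinianRing Rᵐᵒᵖ] [Nontrivial N]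
    (hq : IsLeftQuasiMorphicRing (TrivSqZeroExt R N))
    (hl : ∀ I : Ideal (TrivSqZeroExt R N), I.IsPrincipal)
    (hr : ∀ I : Ideal (TrivSqZeroExt R N)ᵐᵒᵖ, I.IsPrincipal) :
    ∃ σ : R ≃+* R, BimoduleIsomorphic R N (TwistedBimodule (σ : R →+* R)) := by
  obtain ⟨m, hm⟩ : ∃ m : N, ∀ x : N, ∃ r : R, r • m = x := by
    obtain ⟨a, ha⟩ := hl
      { carrier := {z | z.fst = 0}
        add_mem' := fun {a b} ha hb => by
          change (a + b).fst = 0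
          rw [TrivSqZeroExt.fst_add, ha, hb, add_zero]
        zero_mem' := TrivSqZeroExt.fst_zero
        smul_mem' := fun c a ha => by
          change (c * a).fst = 0
          rw [TrivSqZeroExt.fst_mul, ha, mul_zero] }
    rw [SetLike.ext_iff] at ha
    have ha0 : a.fst = 0 := (ha a).2 (Submodule.mem_span_singleton_self a)
    refine ⟨a.snd, fun x => ?_⟩
    obtain ⟨y, hy⟩ := Submodule.mem_span_singleton.1
      ((ha (TrivSqZeroExt.inr x)).1 (TrivSqZeroExt.fst_inr R x))
    have := congrArg TrivSqZeroExt.snd hy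
    rw [smul_eq_mul, TrivSqZeroExt.snd_mul, TrivSqZeroExt.snd_inr, ha0, op_zero, zero_smul,
      add_zero] at this
    exact ⟨y.fst, this⟩
  obtain ⟨m', hm'⟩ : ∃ m : N, ∀ x : N, ∃ r : R, op r • m = x := by
    obtain ⟨a, ha⟩ := hr
      { carrier := {z | (unop z).fst = 0}
        add_mem' := fun {a b} ha hb => by
          change (unop a + unop b).fst = 0
          rw [TrivSqZeroExt.fst_add, ha, hb, add_zero]
        zero_mem' := TrivSqZeroExt.fst_zero
        smul_mem' := fun c a ha => by
          change (unop a * unop c).fst = 0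
          rw [TrivSqZeroExt.fst_mul, ha, zero_mul] }
    rw [SetLike.ext_iff] at ha
    have ha0 : (unop a).fst = 0 := (ha a).2 (Submodule.mem_span_singleton_self a)
    refine ⟨(unop a).snd, fun x => ?_⟩
    obtain ⟨y, hy⟩ := Submodule.mem_span_singleton.1
      ((ha (op (TrivSqZeroExt.inr x))).1 (TrivSqZeroExt.fst_inr R x))
    have := congrArg (fun z => (unop z).snd) hy
    simp only [smul_eq_mul, unop_mul, TrivSqZeroExt.snd_mul, unop_op, TrivSqZeroExt.snd_inr, ha0,
      zero_smul, zero_add] at this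
    exact ⟨(unop y).fst, this⟩
  have hfaithful : ∀ c : R, (∀ x : N, op c • x = 0) → c = 0 := by
    intro c hc
    have h1 : Module.toAddMonoidEnd Rᵐᵒᵖ N (op c) = Module.toAddMonoidEnd Rᵐᵒᵖ N 0 := by
      ext x
      rw [map_zero]
      exact hc x
    have : Nontrivial (AddMonoid.End N) := by
      obtain ⟨x, hx⟩ := exists_ne (0 : N)
      exact ⟨⟨1, 0, fun h0 => hx (DFunLike.congr_fun h0 x)⟩⟩
    exact op_injective (RingHom.injective _ h1)
  -- `0 × N`, generated by `(0, m)`, is `ann_l(c)`. The first entry of `c` kills `N`, so it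
  -- vanishes, and then the second entry must be free. It equals `t m` with `t` right regular, hence
  -- a unit, so `m` is free too.
  have hfree : ∀ x : R, x • m = 0 → x = 0 := by
    obtain ⟨-, c, -, hc⟩ := hq (TrivSqZeroExt.inr m)
    rw [leftAnn_eq_leftPrincipal] at hc
    have hc0 : c.fst = 0 := hfaithful _ fun x => by
      obtain ⟨r, rfl⟩ := hm x
      have h1 := (hc (TrivSqZeroExt.inr (r • m))).2 ⟨TrivSqZeroExt.inl r, by
        ext <;> simp⟩
      have h2 := congrArg TrivSqZeroExt.snd h1
      simpa [TrivSqZeroExt.snd_mul] using h2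
    have hcfree : ∀ x : R, x • c.snd = 0 → x = 0 := by
      intro x hx
      obtain ⟨y, hy⟩ := (hc (TrivSqZeroExt.inl x)).1 (by
        ext
        · simp [hc0]
        · simp [hx])
      have h2 := congrArg TrivSqZeroExt.fst hy
      simpa using h2.symm
    obtain ⟨t, ht⟩ := hm c.snd
    have htu : IsUnit t := by
      rw [IsArtinianRing.isUnit_iff_isRightRegular, isRightRegular_iff_left_eq_zero_of_mul]
      intro x hx
      exact hcfree x (by rw [← ht, ← mul_smul, hx, zero_smul])
    obtain ⟨w, hw⟩ := htu.exists_left_inv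
    intro x hx
    have h1 : x * w = 0 := hcfree _ (by rw [← ht, ← mul_smul, mul_assoc, hw, mul_one, hx])
    rw [← mul_one x, ← hw, ← mul_assoc, h1, zero_mul]
  have huniq : ∀ x y : R, x • m = y • m → x = y := fun x y hxy =>
    sub_eq_zero.1 (hfree _ (by rw [sub_smul, hxy, sub_self]))
  choose s hs using fun r : R => hm (op r • m)
  let σ : R →+* R :=
    { toFun := s
      map_one' := huniq _ _ (by rw [hs, op_one, one_smul, one_smul])
      map_zero' := huniq _ _ (by rw [hs, op_zero, zero_smul, zero_smul])
      map_add' := fun a b => huniq _ _ (by rw [hs, op_add, add_smul, add_smul, hs, hs])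
      map_mul' := fun a b => huniq _ _ (by
        rw [hs, op_mul, mul_smul, mul_smul, hs, ← hs a, smul_comm (s a)]) }
  have hσ : ∀ r, σ r • m = op r • m := hs
  have hσinj : Function.Injective σ := σ.injective
  -- Writing `m = m' t`, injectivity of `σ` makes `t` left regular, hence a unit, so `m` also
  -- generates `N` on the right.
  have hσsurj : Function.Surjective σ := by
    obtain ⟨t, ht⟩ := hm' m
    have htu : IsUnit t := by
      rw [IsArtinianRing.isUnit_iff_isLeftRegular, isLeftRegular_iff_right_eq_zero_of_mul]
      intro x hx
      apply hσinj
      apply huniq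
      rw [hσ, map_zero, zero_smul, ← ht, ← mul_smul, ← op_mul, hx, op_zero, zero_smul]
    obtain ⟨w, hw⟩ := htu.exists_right_inv
    intro y
    obtain ⟨x, hx⟩ := hm' (y • m)
    refine ⟨w * x, huniq _ _ ?_⟩
    calc σ (w * x) • m = op (w * x) • op t • m' := by rw [hσ, ht]
      _ = y • m := by rw [← mul_smul, ← op_mul, ← mul_assoc, hw, one_mul, hx]
  refine ⟨RingEquiv.ofBijective σ ⟨hσinj, hσsurj⟩, ?_⟩
  set τ := RingEquiv.ofBijective σ ⟨hσinj, hσsurj⟩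
  let φ : TwistedBimodule (τ : R →+* R) ≃+ N := AddEquiv.ofBijective
    ((AddMonoidHom.mk' (fun x : R => x • m) fun a b => add_smul a b m).comp
      ((TwistedBimodule.of (τ : R →+* R)).symm : TwistedBimodule (τ : R →+* R) →+ R))
    ⟨fun x y hxy => huniq x y hxy, fun x => hm x⟩
  have hφ : ∀ x, φ (TwistedBimodule.of (τ : R →+* R) x) = x • m := fun _ => rfl
  refine ⟨φ.symm, fun r x => ?_, fun r x => ?_⟩ <;>
    obtain ⟨y, rfl⟩ := φ.surjective x <;>
    obtain ⟨y, rfl⟩ := (TwistedBimodule.of (τ : R →+* R)).surjective y <;>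
    rw [AddEquiv.symm_apply_eq, AddEquiv.symm_apply_apply]
  · rw [TwistedBimodule.smul_of, hφ, hφ, mul_smul]
  · rw [TwistedBimodule.op_smul_of, hφ, hφ, mul_smul, ← smul_comm y]
    exact congrArg (y • ·) (hσ r).symm

/-- A bimodule over a matrix ring over a chain ring whose trivial extension is a quasi-morphic
principal ring is zero, or the ring is simple artinian and the bimodule is a twist of it. -/
theorem IsChainRing.subsingleton_or_exists_twist (h : IsChainRing L p n) (hk : 0 < k)
    (hq : IsQuasiMorphicRing (TrivSqZeroExt (Matrix (Fin k) (Fin k) L) N))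
    (hl : ∀ I : Ideal (TrivSqZeroExt (Matrix (Fin k) (Fin k) L) N), I.IsPrincipal)
    (hr : ∀ I : Ideal (TrivSqZeroExt (Matrix (Fin k) (Fin k) L) N)ᵐᵒᵖ, I.IsPrincipal) :
    Subsingleton N ∨ IsSimpleArtinianRing (Matrix (Fin k) (Fin k) L) ∧
      ∃ σ : Matrix (Fin k) (Fin k) L ≃+* Matrix (Fin k) (Fin k) L,
        BimoduleIsomorphic (Matrix (Fin k) (Fin k) L) N
          (TwistedBimodule (σ : Matrix (Fin k) (Fin k) L →+* Matrix (Fin k) (Fin k) L)) := by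
  rcases subsingleton_or_nontrivial N with hN | hN
  · exact Or.inl hN
  -- For `p = 0` every element of `L` is zero or a unit, so `L` is a division ring.
  by_cases hp : p = 0
  · right
    have := h.nontrivial
    have hdiv : IsSimpleRing L := by
      let _ : DivisionRing L := DivisionRing.ofIsUnitOrEqZero fun x =>
        (h.left x).imp_right fun ⟨y, hy⟩ => by rw [hy, hp, mul_zero]
      infer_instance
    have : NeZero k := ⟨hk.ne'⟩
    have := h.isArtinianRing
    have := h.op.isArtinianRing
    have hop : IsArtinianRing (Matrix (Fin k) (Fin k) L)ᵐᵒᵖ :=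
      (RingEquiv.mopMatrix (m := Fin k) (α := L)).surjective.isArtinianRing
    exact ⟨⟨inferInstance, isTwoSidedArtinianRing_iff.2 ⟨inferInstance, hop⟩⟩,
      exists_twist_of_isSimpleRing hq.1 hl hr⟩
  · exact Or.inl (h.subsingleton_of_ne_zero hp hl)

end ChainBimodule

/-! ### Passage to direct factors -/

section Retract

variable {S B : Type*} [Ring S] [Ring B]

/-- Left quasi-morphicity passes to a ring direct factor. -/
theorem IsLeftQuasiMorphicRing.of_retract (h : IsLeftQuasiMorphicRing S) (f : S →+* B)
    (q : B → S) (E : S) (hfq : ∀ x, f (q x) = x) (hqf : ∀ s, q (f s) = E * s) : IsLeftQuasiMorphicRing B := by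
  have hEq : ∀ x, E * q x = q x := fun x => by rw [← hqf, hfq]
  have hq0 : q 0 = 0 := by rw [← map_zero f, hqf, mul_zero]
  intro a
  obtain ⟨b, c, hb, hc⟩ := h (q a)
  rw [leftAnn_eq_leftPrincipal] at hb hc
  refine ⟨f b, f c, ?_, ?_⟩ <;> rw [leftAnn_eq_leftPrincipal] <;> intro x
  · constructor
    · intro hx
      obtain ⟨y, hy⟩ := (hb (q x)).1 (by
        rw [← hEq x, mul_assoc, ← hqf, map_mul, hfq, hfq, hx, hq0])
      exact ⟨f y, by rw [← map_mul, hy, hfq]⟩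
    · rintro ⟨y, rfl⟩
      rw [mul_assoc, ← hfq a, ← map_mul, (hb b).2 ⟨1, one_mul b⟩, map_zero, mul_zero]
  · constructor
    · intro hx
      obtain ⟨y, hy⟩ := (hc (q x)).1 (by
        rw [← hEq x, mul_assoc, ← hqf, map_mul, hfq, hx, hq0])
      exact ⟨f y, by rw [← hfq a, ← map_mul, hy, hfq]⟩
    · rintro ⟨y, rfl⟩
      rw [mul_assoc, ← hfq a, ← map_mul, (hc (q a)).2 ⟨1, one_mul _⟩, map_zero, mul_zero]

/-- Centrality of `E` turns the identity for `q ∘ f` into its mirror image, so the left-sided result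
applies to the opposite rings. -/
theorem IsQuasiMorphicRing.of_retract (h : IsQuasiMorphicRing S) (f : S →+* B)
    (q : B → S) (E : S) (hfq : ∀ x, f (q x) = x) (hqf : ∀ s, q (f s) = E * s)
    (hE : ∀ s, E * s = s * E) : IsQuasiMorphicRing B :=
  ⟨h.1.of_retract f q E hfq hqf,
    isRightQuasiMorphicRing_iff.2 <| h.op.1.of_retract f.op
      (fun x => MulOpposite.op (q (unop x))) (MulOpposite.op E)
      (fun x => congrArg MulOpposite.op (hfq (unop x)))
      fun s => congrArg MulOpposite.op ((hqf (unop s)).trans (hE _))⟩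

end Retract

/-! ### The bimodule summand cut out by a central idempotent -/

section CornerBimodule

variable {R : Type u} {B : Type*} [Ring R] [Ring B]

/-- The summand `e M` of `M` for the idempotent `e = j 1`, where `j` embeds the ring `B` into `R`
without preserving the unit. -/
def CornerModule (j : B →ₙ+* R) (M : Type v) [AddCommGroup M] [Module R M] : AddSubgroup M where
  carrier := {m | j 1 • m = m}
  add_mem' := fun {a b} ha hb => by
    change j 1 • (a + b) = a + b
    rw [smul_add, ha, hb]
  zero_mem' := smul_zero _
  neg_mem' := fun {a} ha => by
    change j 1 • (-a) = -a
    rw [smul_neg, ha]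

variable (j : B →ₙ+* R) {M : Type v} [AddCommGroup M] [Module R M]

theorem CornerModule.idem_smul (m : CornerModule j M) : j 1 • (m : M) = m := m.2

instance : Module B (CornerModule j M) where
  smul b m := ⟨j b • (m : M), by
    change j 1 • j b • (m : M) = j b • (m : M)
    rw [← mul_smul, ← map_mul, one_mul]⟩
  one_smul m := Subtype.ext m.2
  mul_smul a b m := Subtype.ext (by
    change j (a * b) • (m : M) = j a • j b • (m : M)
    rw [map_mul, mul_smul])
  smul_zero a := Subtype.ext (smul_zero (j a))
  smul_add a x y := Subtype.ext (smul_add (j a) (x : M) y)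
  add_smul a b x := Subtype.ext (by
    change j (a + b) • (x : M) = j a • (x : M) + j b • (x : M)
    rw [map_add, add_smul])
  zero_smul x := Subtype.ext (by
    change j 0 • (x : M) = 0
    rw [map_zero, zero_smul])

/-- The projection of `M` onto the summand `e M`. -/
def CornerModule.proj : M →+ CornerModule j M where
  toFun m := ⟨j 1 • m, by
    change j 1 • j 1 • m = j 1 • m
    rw [← mul_smul, ← map_mul, one_mul]⟩
  map_zero' := Subtype.ext (smul_zero _)
  map_add' a b := Subtype.ext (smul_add _ a b)

theorem CornerModule.coe_proj (m : M) : (CornerModule.proj j m : M) = j 1 • m := rfl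

variable [Module Rᵐᵒᵖ M] [SMulCommClass R Rᵐᵒᵖ M]

/-- The right module structure on `e M = M e`. -/
abbrev CornerModule.rightModule (h : ∀ m : M, j 1 • m = op (j 1) • m) :
    Module Bᵐᵒᵖ (CornerModule j M) where
  smul b m := ⟨op (j (unop b)) • (m : M), by
    change j 1 • op (j (unop b)) • (m : M) = op (j (unop b)) • (m : M)
    rw [smul_comm, m.2]⟩
  one_smul m := Subtype.ext ((h m).symm.trans m.2)
  mul_smul a b m := Subtype.ext (by
    change op (j (unop b * unop a)) • (m : M) = op (j (unop a)) • op (j (unop b)) • (m : M)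
    rw [map_mul, op_mul, mul_smul])
  smul_zero a := Subtype.ext (smul_zero (op (j (unop a))))
  smul_add a x y := Subtype.ext (smul_add (op (j (unop a))) (x : M) y)
  add_smul a b x := Subtype.ext (by
    change op (j (unop a + unop b)) • (x : M) =
      op (j (unop a)) • (x : M) + op (j (unop b)) • (x : M)
    rw [map_add, op_add, add_smul])
  zero_smul x := Subtype.ext (by
    change op (j 0) • (x : M) = 0
    rw [map_zero, op_zero, zero_smul])

theorem CornerModule.smulCommClass (h : ∀ m : M, j 1 • m = op (j 1) • m) :
    letI := CornerModule.rightModule j h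
    SMulCommClass B Bᵐᵒᵖ (CornerModule j M) :=
  letI := CornerModule.rightModule j h
  ⟨fun a b m => Subtype.ext (smul_comm (j a) (op (j (unop b))) (m : M))⟩

/-- If `B` is a ring direct factor of `R` and the corresponding idempotent commutes with `M`,
then `B ∝ e M` inherits from `R ∝ M` that it is quasi-morphic and principal. -/
theorem CornerModule.trivSqZeroExt (π : R →+* B) (hπ : ∀ b, π (j b) = b)
    (hj : ∀ r, j (π r) = j 1 * r) (hc : ∀ r, j 1 * r = r * j 1)
    (h : ∀ m : M, j 1 • m = op (j 1) • m) :
    letI := CornerModule.rightModule j h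
    letI := CornerModule.smulCommClass j h
    (IsQuasiMorphicRing (TrivSqZeroExt R M) →
      IsQuasiMorphicRing (TrivSqZeroExt B (CornerModule j M))) ∧
    ∃ f : TrivSqZeroExt R M →+* TrivSqZeroExt B (CornerModule j M), Function.Surjective f := by
  let := CornerModule.rightModule j h
  let := CornerModule.smulCommClass j h
  have hee : j 1 * j 1 = j 1 := by rw [← map_mul, one_mul]
  have hop : ∀ (r : R) (m : M), op (j (π r)) • j 1 • m = j 1 • op r • m := by
    intro r m
    rw [hj, hc, op_mul, mul_smul, smul_comm (j 1) (op r), h m, ← mul_smul, ← mul_smul,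
      ← mul_smul, ← op_mul, ← op_mul, ← op_mul, ← hc r, ← mul_assoc, hee]
  let f : TrivSqZeroExt R M →+* TrivSqZeroExt B (CornerModule j M) :=
    { toFun := fun z => TrivSqZeroExt.inl (π z.fst) + TrivSqZeroExt.inr (CornerModule.proj j z.snd)
      map_one' := by
        ext
        · simp
        · simp
      map_zero' := by
        ext
        · simp
        · simp
      map_add' := fun x y => by
        ext
        · simp
        · simp
      map_mul' := fun x y => by
        ext
        · simp
        · simp only [TrivSqZeroExt.snd_add, TrivSqZeroExt.snd_inl, TrivSqZeroExt.snd_inr,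
            TrivSqZeroExt.snd_mul, TrivSqZeroExt.fst_add, TrivSqZeroExt.fst_inl,
            TrivSqZeroExt.fst_inr, add_zero, zero_add, map_add, AddSubgroup.coe_add]
          congr 1
          · change j 1 • x.fst • y.snd = j (π x.fst) • j 1 • y.snd
            rw [hj, ← mul_smul, ← mul_smul, mul_assoc, ← hc, ← mul_assoc, hee]
          · exact (hop y.fst x.snd).symm }
  let q : TrivSqZeroExt B (CornerModule j M) → TrivSqZeroExt R M := fun z =>
    TrivSqZeroExt.inl (j z.fst) + TrivSqZeroExt.inr (z.snd : M)
  have hfq : ∀ x, f (q x) = x := by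
    intro x
    ext
    · simp [f, q, hπ]
    · simp [f, q, CornerModule.coe_proj, CornerModule.idem_smul]
  have hqf : ∀ s, q (f s) = TrivSqZeroExt.inl (j 1) * s := by
    intro s
    ext
    · simp [f, q, hj]
    · simp [f, q, CornerModule.coe_proj]
  refine ⟨fun hq => hq.of_retract f q (TrivSqZeroExt.inl (j 1)) hfq hqf fun s => ?_, f,
    fun x => ⟨q x, hfq x⟩⟩
  ext
  · simp [hc]
  · simp [h]

end CornerBimodule

/-! ### Splitting the bimodule and conclusion -/

section Main

variable {R : Type u} {M : Type v} [Ring R] [AddCommGroup M] [Module R M]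
    [Module Rᵐᵒᵖ M] [SMulCommClass R Rᵐᵒᵖ M]

/-- If `R ∝ M` is left noetherian with principal left ideals, central idempotents of `R` commute
with `M`. -/
theorem idem_smul_eq_op_smul [IsNoetherianRing (TrivSqZeroExt R M)]
    (hP : ∀ I : Ideal (TrivSqZeroExt R M), I.IsPrincipal) {e : R} (he : e * e = e)
    (hc : ∀ r, e * r = r * e) (m : M) : e • m = op e • m := by
  let K : Ideal (TrivSqZeroExt R M) := RingHom.ker (TrivSqZeroExt.fstHom ℕ R M)
  have hK : IsNilpotent K := by
    -- The filtration is the whole ring, then `0 × M`, then `0`, reflecting that `0 × M` has square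
    -- zero.
    refine isNilpotent_of_filtration
      (fun i => {x | (0 < i → x.fst = 0) ∧ (1 < i → x.snd = 0)}) 2 (fun x => ⟨?_, ?_⟩)
      (fun i x y hx hy => ⟨?_, ?_⟩) (fun i x y hx hy => ⟨?_, ?_⟩) (fun x hx => ?_)
    · omega
    · omega
    · intro hi
      rw [TrivSqZeroExt.fst_add, hx.1 hi, hy.1 hi, add_zero]
    · intro hi
      rw [TrivSqZeroExt.snd_add, hx.2 hi, hy.2 hi, add_zero]
    · intro _
      have hy0 : y.fst = 0 := hy
      rw [TrivSqZeroExt.fst_mul, hy0, mul_zero]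
    · intro hi
      have hy0 : y.fst = 0 := hy
      rw [TrivSqZeroExt.snd_mul, hy0, hx.1 (by omega), op_zero, zero_smul, zero_smul, add_zero]
    · exact TrivSqZeroExt.ext (hx.1 (by omega)) (hx.2 (by omega))
  -- `(e, 0)` is central modulo `0 × M`, hence central; commuting it with `(0, m)` gives the claim.
  have := commute_of_idempotent hP hK (e := TrivSqZeroExt.inl e)
    (by rw [TrivSqZeroExt.inl_mul_inl, he])
    (fun x => by
      change (TrivSqZeroExt.inl e * x - x * TrivSqZeroExt.inl e).fst = 0
      simp [hc]) (TrivSqZeroExt.inr m)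
  simpa using congrArg TrivSqZeroExt.snd this

/-- The block idempotents `j i 1` of `R` are central and act equally on both sides of `M`. So `M` is
the direct sum of its corners, and each block with its corner is a direct factor of `R ∝ M`, to
which the single-block dichotomy applies. -/
theorem hasMatrixTwistDecomposition (hqm : IsQuasiMorphicRing (TrivSqZeroExt R M))
    [IsNoetherianRing (TrivSqZeroExt R M)] [IsArtinianRing R] (hR : IsPrincipalRing R) :
    HasMatrixTwistDecomposition R M := by
  obtain ⟨-, hSP⟩ := hqm.isTwoSidedArtinianRing_and_isPrincipalRing
  rw [isPrincipalRing_iff] at hSP hR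
  obtain ⟨n, k, L, _, p, s, ⟨e⟩, hk, hL⟩ := exists_ringEquiv_pi_matrix_isChainRing hR.1 hR.2
  let B : Fin n → Type u := fun i => Matrix (Fin (k i)) (Fin (k i)) (L i)
  let j : ∀ i, B i →ₙ+* R := fun i =>
    { toFun := fun b => e.symm (Pi.single i b)
      map_zero' := by rw [Pi.single_zero, map_zero]
      map_add' := fun a b => by rw [Pi.single_add, map_add]
      map_mul' := fun a b => by rw [Pi.single_mul, map_mul] }
  have hj : ∀ i b, j i b = e.symm (Pi.single i b) := fun _ _ => rfl
  let π : ∀ i, R →+* B i := fun i => (Pi.evalRingHom B i).comp (e : R →+* ∀ i, B i)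
  have hπ : ∀ i r, π i r = e r i := fun _ _ => rfl
  have hπj : ∀ i b, π i (j i b) = b := fun i b => by
    rw [hπ, hj, RingEquiv.apply_symm_apply, Pi.single_eq_same]
  have hjπ : ∀ i r, j i (π i r) = j i 1 * r := fun i r => by
    apply e.injective
    rw [hj, hj, hπ, map_mul, RingEquiv.apply_symm_apply, RingEquiv.apply_symm_apply]
    ext l : 1
    rcases eq_or_ne l i with rfl | h
    · simp
    · simp [h]
  have hc : ∀ i r, j i 1 * r = r * j i 1 := fun i r => by
    apply e.injective
    rw [hj, map_mul, map_mul, RingEquiv.apply_symm_apply]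
    ext l : 1
    rcases eq_or_ne l i with rfl | h
    · simp
    · simp [h]
  have hjj : ∀ i, j i 1 * j i 1 = j i 1 := fun i => by rw [← map_mul, one_mul]
  have horth : ∀ i l, i ≠ l → j i 1 * j l 1 = 0 := fun i l hil => by
    rw [← hjπ, hπ, hj l, RingEquiv.apply_symm_apply, Pi.single_eq_of_ne hil, map_zero]
  have hsum : ∑ i, j i 1 = 1 := by
    apply e.injective
    rw [map_sum, map_one]
    simp only [hj, RingEquiv.apply_symm_apply]
    exact Finset.univ_sum_single (1 : ∀ i, B i)
  have hM : ∀ i (m : M), j i 1 • m = op (j i 1) • m := fun i =>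
    idem_smul_eq_op_smul hSP.1 (hjj i) (hc i)
  let F : M →+ (∀ i, CornerModule (j i) M) := AddMonoidHom.mk' (fun m i => CornerModule.proj (j i) m)
    fun a b => funext fun i => map_add _ a b
  have hF : ∀ m i, ((F m i : CornerModule (j i) M) : M) = j i 1 • m := fun _ _ => rfl
  have hFbij : Function.Bijective F := by
    constructor
    · rw [injective_iff_map_eq_zero]
      intro m hm
      have h0 : ∀ i, j i 1 • m = 0 := fun i => by rw [← hF, hm]; rfl
      rw [← one_smul R m, ← hsum, Finset.sum_smul]
      exact Finset.sum_eq_zero fun i _ => h0 i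
    · intro x
      refine ⟨∑ l, (x l : M), funext fun i => Subtype.ext ?_⟩
      rw [hF, Finset.smul_sum, Finset.sum_eq_single i]
      · exact (x i).2
      · intro l _ hl
        rw [← CornerModule.idem_smul (j l) (x l), ← mul_smul, horth i l hl.symm, zero_smul]
      · simp
  let right : ∀ i, Module (B i)ᵐᵒᵖ (CornerModule (j i) M) := fun i =>
    CornerModule.rightModule (j i) (hM i)
  have comm : ∀ i, SMulCommClass (B i) (B i)ᵐᵒᵖ (CornerModule (j i) M) := fun i =>
    CornerModule.smulCommClass (j i) (hM i)
  have key := fun i => CornerModule.trivSqZeroExt (j i) (π i) (hπj i) (hjπ i) (hc i) (hM i)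
  have hdich : ∀ i, Subsingleton (CornerModule (j i) M) ∨ IsSimpleArtinianRing (B i) ∧
      ∃ σ : B i ≃+* B i, BimoduleIsomorphic (B i) (CornerModule (j i) M)
        (TwistedBimodule (σ : B i →+* B i)) := fun i => by
    obtain ⟨hq, f, hf⟩ := key i
    exact (hL i).subsingleton_or_exists_twist (hk i) (hq hqm)
      (forall_isPrincipal_of_surjective f hf hSP.1)
      (forall_isPrincipal_op_of_surjective f hf hSP.2)
  refine ⟨n, k, L, inferInstance, fun i => CornerModule (j i) M, fun i => inferInstance,
    fun i => inferInstanceAs (Module (B i) (CornerModule (j i) M)), right, comm, e,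
    AddEquiv.ofBijective F hFbij, hk,
    fun i => ⟨(hL i).isLocalRing, (hL i).isTwoSidedArtinianRing, (hL i).isPrincipalRing⟩,
    fun r m i => Subtype.ext ?_, fun r m i => Subtype.ext ?_,
    fun i _ => (hdich i).imp_right And.right,
    fun i hi => (hdich i).resolve_right fun h => hi h.1⟩
  · change j i 1 • r • m = j i (π i r) • j i 1 • m
    rw [hjπ, ← mul_smul, ← mul_smul, mul_assoc, ← hc, ← mul_assoc, hjj]
  · change j i 1 • op r • m = op (j i (π i r)) • j i 1 • m
    rw [hjπ, hc, op_mul, mul_smul, hM i m, hM i, ← mul_smul, ← mul_smul, ← mul_smul, ← op_mul,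
      ← op_mul, ← hc i r, ← mul_assoc, hjj]

end Main

theorem mainTheorem11 {R : Type u} {M : Type v} [Ring R] [AddCommGroup M] [Module R M]
    [Module Rᵐᵒᵖ M] [SMulCommClass R Rᵐᵒᵖ M]
    (hqm : IsQuasiMorphicRing (TrivSqZeroExt R M))
    (hacc : ACCPrincipalLeftIdeals R)
    (hfg : Module.Finite R M) :
    IsTwoSidedArtinianRing R ∧ IsPrincipalRing R ∧
      IsMorphicRing (TrivSqZeroExt R M) ∧
      HasMatrixTwistDecomposition R M := by
  have := TrivSqZeroExt.isNoetherianRing_of_isQuasiMorphicRing hqm hacc hfg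
  obtain ⟨hart, hprin⟩ := hqm.isTwoSidedArtinianRing_and_isPrincipalRing
  obtain ⟨hartl, hartr⟩ := isTwoSidedArtinianRing_iff.1 hart
  obtain ⟨hprinl, hprinr⟩ := isPrincipalRing_iff.1 hprin
  let f : TrivSqZeroExt R M →+* R := TrivSqZeroExt.fstHom ℕ R M
  have hf : Function.Surjective f := TrivSqZeroExt.fst_surjective
  have hfop : Function.Surjective f.op := fun y => by
    obtain ⟨x, hx⟩ := hf (unop y)
    exact ⟨op x, congrArg op hx⟩
  have hRl : IsArtinianRing R := hf.isArtinianRing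
  have hRr : IsArtinianRing Rᵐᵒᵖ := hfop.isArtinianRing
  have hRP : IsPrincipalRing R := isPrincipalRing_iff.2
    ⟨forall_isPrincipal_of_surjective f hf hprinl, forall_isPrincipal_of_surjective f.op hfop hprinr⟩
  -- Morphicity comes from the structure theorem applied to `R ∝ M` itself, independently of the
  -- decomposition of `M`.
  exact ⟨isTwoSidedArtinianRing_iff.2 ⟨hRl, hRr⟩, hRP, isMorphicRing_of_isArtinianRing hprin,
    hasMatrixTwistDecomposition hqm hRP⟩
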